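/- **Proposition (Dolgopyat type estimate).** Let $A$ be an aperiodic $N\times N$ matrix with entries in $\{0,1\}$ (some power $A^m$, $m\ge 1$, is positive), let $X\subset\{1,\dots,N\}^{\mathbb Z}$ and $X^+\subset\{1,\dots,N\}^{\mathbb N}$ be the two-sided and one-sided subshifts of finite type defined by $A$, and let $\sigma$ be the shift. For $\lambda\in(0,1)$ equip $X^+$ with the metric $d_\lambda(x,y)=\lambda^{\min\{i:\,x_i\ne y_i\}}$ for $x\neq y$, let $F_\lambda(X^+)$ be the space of complex-valued Lipschitz functions on $(X^+,d_\lambda)$, and write $|h|_{Lip}$ for the Lipschitz seminorm and $|h|_\infty$ for the supremum norm. Let $r:X^+\to(0,\infty)$ and $\varphi:X^+\to\mathbb R$ be Lipschitz, where $r$ is also viewed as a function on $X$ depending only on the coordinates $x_i$, $i\ge 0$, and assume that $\varphi$ is normalized: $\sum_{\sigma(y)=x}e^{\varphi(y)}=1$ for all $x\in X^+$. For $b\in\mathbb R$ put $$\mathcal L_b h(x)=\sum_{\sigma(y)=x}e^{\varphi(y)+ibr(y)}h(y).$$ For $n\in\mathbb N$ let $W^s_n(x)=\{y\in X:y_i=x_i\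 \forall i\ge n\}$ and $W^u_n(x)=\{y\in X: y_i=x_i\ \forall i\le -n\}$, let $r_n=\sum_{i=0}^{n-1}r\circ\sigma^i$, $\Delta^s(x,y)=\lim_n\,(r_n(y)-r_n(x))$ for $y\in\bigcup_nW^s_n(x)$, and $\Delta^u(x,y)=\lim_n\,(r_n(\sigma^{-n}x)-r_n(\sigma^{-n}y))$ for $y\in\bigcup_nW^u_n(x)$. Call $(w_0,w_1,w_2,w_3)\in X^4$ a quadrilateral of size $n$ based at $w_0$ if $w_1\in W^u_n(w_0)$, $w_2\in W^s_n(w_0)$ and $w_3\in W^u_n(w_2)\cap W^s_n(w_1)$; its displacement is $$D(w_0,w_1,w_2,w_3)=\Delta^u(w_0,w_1)+\Delta^s(w_1,w_3)+\Delta^u(w_3,w_2)+\Delta^s(w_2,w_0).$$ (1) Suppose that for some $C_2>0$, $C_3>0$, $C_4>1$, $w_0\in X$ and $N_0\ge 1$ the following Diophantine non-integrability property holds: for every real $b$ with $|b|\ge C_4$ there is a quadrilateral $(w_0,w_1,w_2,w_3)$ of size $N_0$ with $|e^{ibD(w_0,w_1,w_2,w_3)}-1|\ge C_3|b|^{-C_2}$.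 Then there are constants $C_8,C_9,C_{10}>0$ such that for every real $b$ with $|b|\ge C_4$ and every $h\in F_\lambda(X^+)$, with $n=\lfloor C_8\log|b|\rfloor$, one has $\mathcal L_b^{n}h\in F_\lambda(X^+)$ and $$\|\mathcal L_b^{n}h\|_b\le(1-|b|^{-C_9})\|h\|_b,\qquad \|h\|_b=\max\Big\{|h|_\infty,\ \frac{|h|_{Lip}}{C_{10}|b|}\Big\}.$$ (2) In particular, if there are a point $w_0\in X$ and two displacements $\alpha,\beta$ of quadrilaterals based at $w_0$ (of any sizes) such that $\alpha/\beta$ is Diophantine, i.e. there are $C,\gamma>0$ with $|q\frac{\alpha}{\beta}-p|\ge C|q|^{-\gamma}$ for all $p,q\in\mathbb Z$ with $q\ne 0$, then the property in (1) holds at $w_0$ for some $C_2,C_3>0$, $C_4>1$ and $N_0\ge1$, and hence so does the estimate in (1) for all $|b|\ge C_4$. -/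

import Mathlib

open Filter Topology

noncomputable section

namespace Subshift

/-- The matrix `A` has entries zero and one. -/
def IsZeroOne {N : ℕ} (A : Matrix (Fin N) (Fin N) ℕ) : Prop :=
  ∀ i j, A i j = 0 ∨ A i j = 1

/-- The matrix `A` is aperiodic: some power `A ^ m` with `m ≥ 1` is a positive matrix. -/
def IsAperiodic {N : ℕ} (A : Matrix (Fin N) (Fin N) ℕ) : Prop :=
  ∃ m : ℕ, 1 ≤ m ∧ ∀ i j, 0 < (A ^ m) i j

/-- The one-sided symbolic space `X⁺`. -/
def OneSided {N : ℕ} (A : Matrix (Fin N) (Fin N) ℕ) : Type :=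
  {x : ℕ → Fin N // ∀ i, A (x i) (x (i + 1)) = 1}

/-- The two-sided symbolic space `X`. -/
def TwoSided {N : ℕ} (A : Matrix (Fin N) (Fin N) ℕ) : Type :=
  {x : ℤ → Fin N // ∀ i, A (x i) (x (i + 1)) = 1}

variable {N : ℕ} {A : Matrix (Fin N) (Fin N) ℕ}

/-- The shift `σ : X⁺ → X⁺`, `(σ x)ᵢ = xᵢ₊₁`. -/
def shift (x : OneSided A) : OneSided A :=
  ⟨fun i => x.1 (i + 1), fun i => x.2 (i + 1)⟩

/-- The `k`-th power `σᵏ` (`k ∈ ℤ`) of the two-sided shift `σ : X → X`, `(σᵏ x)ᵢ = xᵢ₊ₖ`. -/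
def shiftBy (k : ℤ) (x : TwoSided A) : TwoSided A :=
  ⟨fun i => x.1 (i + k), fun i => by
    have h := x.2 (i + k)
    rwa [show i + k + 1 = i + 1 + k by ring] at h⟩

/-- The coordinate projection `Π₊ : X → X⁺`. -/
def proj (x : TwoSided A) : OneSided A :=
  ⟨fun i => x.1 (i : ℤ), fun i => by
    have h := x.2 (i : ℤ)
    simpa using h⟩

open Classical in
/-- The metric `d_λ(x, y) = λ ^ min {i : xᵢ ≠ yᵢ}` on `X⁺`, with `d_λ(x, x) = 0`. -/
def symDist (lam : ℝ) (x y : OneSided A) : ℝ :=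
  if x = y then 0 else lam ^ sInf {i : ℕ | x.1 i ≠ y.1 i}

/-- `h` is Lipschitz on `(X⁺, d_λ)`, that is, `h ∈ F_λ(X⁺)`. -/
def IsLip {E : Type} [NormedAddCommGroup E] (lam : ℝ) (h : OneSided A → E) : Prop :=
  ∃ K : ℝ, ∀ x y, ‖h x - h y‖ ≤ K * symDist lam x y

/-- The Lipschitz seminorm `|h|_Lip` (pairs with `x = y` contribute `0 / 0 = 0`). -/
def lipSeminorm (lam : ℝ) (h : OneSided A → ℂ) : ℝ :=
  ⨆ p : OneSided A × OneSided A, ‖h p.1 - h p.2‖ / symDist lam p.1 p.2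

/-- The supremum norm `|h|_∞`. -/
def supNorm (h : OneSided A → ℂ) : ℝ :=
  ⨆ x : OneSided A, ‖h x‖

/-- The norm `‖h‖_b = max {|h|_∞, |h|_Lip / (C |b|)}`. -/
def bNorm (lam C b : ℝ) (h : OneSided A → ℂ) : ℝ :=
  max (supNorm h) (lipSeminorm lam h / (C * |b|))

theorem fiber_finite (x : OneSided A) : {y : OneSided A | shift y = x}.Finite := by
  refine Set.Finite.of_injOn (f := fun y : OneSided A => y.1 0) (t := Set.univ)
    (fun _ _ => Set.mem_univ _) ?_ Set.finite_univ
  intro y hy z hz h0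
  have hyz : shift y = shift z := Eq.trans hy (Eq.symm hz)
  apply Subtype.ext
  funext i
  cases i with
  | zero => exact h0
  | succ i => exact congrFun (congrArg Subtype.val hyz) i

/-- The transfer operator `(𝓛_ψ h)(x) = ∑_{σ y = x} e^{ψ(y)} h(y)` of `ψ : X⁺ → ℂ`. -/
def transfer (ψ : OneSided A → ℂ) (h : OneSided A → ℂ) : OneSided A → ℂ :=
  fun x => ∑ y ∈ (fiber_finite x).toFinset, Complex.exp (ψ y) * h y

/-- The twisted transfer operator `𝓛_b = 𝓛_{φ + i b r}`. -/
def twisted (φ r : OneSided A → ℝ) (b : ℝ) : (OneSided A → ℂ) → (OneSided A → ℂ) :=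
  transfer fun y => (φ y : ℂ) + Complex.I * (b : ℂ) * (r y : ℂ)

/-- `φ` is normalized: `𝓛_φ 1 = 1`. -/
def IsNormalized (φ : OneSided A → ℝ) : Prop :=
  transfer (fun y => (φ y : ℂ)) (fun _ => 1) = fun _ => 1

/-- `W^s_n(x) = {y ∈ X : yᵢ = xᵢ for all i ≥ n}`. -/
def stableSet (n : ℤ) (x : TwoSided A) : Set (TwoSided A) :=
  {y | ∀ i : ℤ, n ≤ i → y.1 i = x.1 i}

/-- `W^u_n(x) = {y ∈ X : yᵢ = xᵢ for all i ≤ -n}`. -/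
def unstableSet (n : ℤ) (x : TwoSided A) : Set (TwoSided A) :=
  {y | ∀ i : ℤ, i ≤ -n → y.1 i = x.1 i}

/-- The sum `r_n = ∑_{i < n} r ∘ σⁱ` on `X`, where `r` depends only on future coordinates. -/
def roofSum (r : OneSided A → ℝ) (n : ℕ) (x : TwoSided A) : ℝ :=
  birkhoffSum (shiftBy 1) (fun z => r (proj z)) n x

/-- `Δ^s(x, y) = lim_n (r_n(y) - r_n(x))`, for `y ∈ W^s(x)`. -/
def deltaS (r : OneSided A → ℝ) (x y : TwoSided A) : ℝ :=
  limUnder atTop fun n : ℕ => roofSum r n y - roofSum r n x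

/-- `Δ^u(x, y) = lim_n (r_n(σ⁻ⁿ x) - r_n(σ⁻ⁿ y))`, for `y ∈ W^u(x)`. -/
def deltaU (r : OneSided A → ℝ) (x y : TwoSided A) : ℝ :=
  limUnder atTop fun n : ℕ =>
    roofSum r n (shiftBy (-(n : ℤ)) x) - roofSum r n (shiftBy (-(n : ℤ)) y)

/-- The total displacement
`Δ^u(w₀, w₁) + Δ^s(w₁, w₃) + Δ^u(w₃, w₂) + Δ^s(w₂, w₀)` of a quadrilateral. -/
def displacement (r : OneSided A → ℝ) (w₀ w₁ w₂ w₃ : TwoSided A) : ℝ :=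
  deltaU r w₀ w₁ + deltaS r w₁ w₃ + deltaU r w₃ w₂ + deltaS r w₂ w₀

/-- `w₁ ∈ W^u_n(w₀)`, `w₂ ∈ W^s_n(w₀)` and `w₃ ∈ W^u_n(w₂) ∩ W^s_n(w₁)`. -/
def IsQuadrilateral (n : ℕ) (w₀ w₁ w₂ w₃ : TwoSided A) : Prop :=
  w₁ ∈ unstableSet n w₀ ∧ w₂ ∈ stableSet n w₀ ∧ w₃ ∈ unstableSet n w₂ ∩ stableSet n w₁

/-- The Diophantine non-integrability property of the suspension with roof function `r`,
with constants `C₂, C₃, C₄`, base point `w₀` and size `N₀`. -/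
def DiophantineNonintegrable (r : OneSided A → ℝ) (C₂ C₃ C₄ : ℝ) (w₀ : TwoSided A)
    (N₀ : ℕ) : Prop :=
  ∀ b : ℝ, C₄ ≤ |b| → ∃ w₁ w₂ w₃ : TwoSided A, IsQuadrilateral N₀ w₀ w₁ w₂ w₃ ∧
    C₃ * |b| ^ (-C₂) ≤
      ‖Complex.exp (Complex.I * (b : ℂ) * (displacement r w₀ w₁ w₂ w₃ : ℂ)) - 1‖

/-- The set of all displacements of quadrilaterals based at `w₀`: the range of the temporal
distance function of the suspension at `w₀`. -/
def temporalRange (r : OneSided A → ℝ) (w₀ : TwoSided A) : Set ℝ :=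
  {t | ∃ (n : ℕ) (w₁ w₂ w₃ : TwoSided A),
    IsQuadrilateral n w₀ w₁ w₂ w₃ ∧ t = displacement r w₀ w₁ w₂ w₃}

/-- The real number `a` is Diophantine. -/
def IsDiophantine (a : ℝ) : Prop :=
  ∃ C γ : ℝ, 0 < C ∧ 0 < γ ∧
    ∀ p q : ℤ, q ≠ 0 → C * |(q : ℝ)| ^ (-γ) ≤ |(q : ℝ) * a - (p : ℝ)|

/-- The Dolgopyat type estimate for all `|b| ≥ C₄`: there are constants `C₈, C₉, C₁₀ > 0` such
that `‖𝓛_bⁿ h‖_b ≤ (1 - |b|^{-C₉}) ‖h‖_b` with `n = ⌊C₈ log |b|⌋`, for every `h ∈ F_λ(X⁺)`.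
The membership `𝓛_bⁿ h ∈ F_λ(X⁺)` is part of the claim. -/
def DolgopyatEstimate (lam : ℝ) (φ r : OneSided A → ℝ) (C₄ : ℝ) : Prop :=
  ∃ C₈ C₉ C₁₀ : ℝ, 0 < C₈ ∧ 0 < C₉ ∧ 0 < C₁₀ ∧
    ∀ b : ℝ, C₄ ≤ |b| → ∀ h : OneSided A → ℂ, IsLip lam h →
      IsLip lam ((twisted φ r b)^[⌊C₈ * Real.log |b|⌋₊] h) ∧
      bNorm lam C₁₀ b ((twisted φ r b)^[⌊C₈ * Real.log |b|⌋₊] h) ≤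
        (1 - |b| ^ (-C₉)) * bNorm lam C₁₀ b h

end Subshift

end

namespace Subshift

variable {N : ℕ} {A : Matrix (Fin N) (Fin N) ℕ}

/-! The sup-norm half is proved by contradiction. Scale `h` so that `|h|_∞ ≤ 1` and `|h|_Lip ≤
C|b|`, a set preserved by `𝓛_b` (`BoundedLip.twisted_iterate`), and suppose that the iterate of
order `n + N₀ + (m + k)` has modulus above `1 - ε` at one point. Since `𝓛_b` averages with weights
at least `e^{-q}`, near-maximal modulus passes to all preimages, the deficit growing by at most
`e^q` per step (`norm_ge_of_iterate`). By aperiodicity the `(m + k)`-th preimages are `λ^k`-dense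
(`exists_preimage_agree`), so the Lipschitz bound gives `|𝓛_b^{n+N₀} h| ≥ 1 - η` everywhere.

An average of unit-disc vectors is close to the unit circle only if the vectors nearly coincide
(`average_near_circle`). Hence `g = 𝓛_b^n h` satisfies both `e^{ibr_{N₀}} g ≈ (𝓛_b^{N₀} g) ∘ σ^{N₀}`
and `e^{ibr_n} h ≈ g ∘ σ^n` (`iterate_near`). The first makes `g` nearly invariant under stable
holonomy twisted by `e^{ibΔ^s}` (`stable_near`), the second under the unstable one
(`unstable_near`). Going around a quadrilateral forces `e^{ibD} ≈ 1` with an error below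
`C₃|b|^{-C₂}`, which non-integrability forbids. The Lipschitz half is a Lasota–Yorke inequality.

For (2), if `e^{ibα}` and `e^{ibβ}` were both too close to 1, then `bα ≈ 2πp` and `bβ ≈ 2πk` with `0
< |k| ≲ |b|`, so `p/k` would approximate `α/β` too well. -/

/-! ### Inverse branches of the one-sided shift -/

/-- The point `a x₀ x₁ …` if the word `a x₀` is admissible, and `x` otherwise. -/
def prepend (a : Fin N) (x : OneSided A) : OneSided A :=
  if h : A a (x.1 0) = 1 then
    ⟨fun i => Nat.casesOn i a x.1, fun i => by
      cases i with
      | zero => exact h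
      | succ i => exact x.2 i⟩
  else x

theorem prepend_zero {a : Fin N} {x : OneSided A} (h : A a (x.1 0) = 1) :
    (prepend a x).1 0 = a := by
  simp [prepend, h]

theorem prepend_succ {a : Fin N} {x : OneSided A} (h : A a (x.1 0) = 1) (i : ℕ) :
    (prepend a x).1 (i + 1) = x.1 i := by
  simp [prepend, h]

theorem shift_prepend {a : Fin N} {x : OneSided A} (h : A a (x.1 0) = 1) :
    shift (prepend a x) = x :=
  Subtype.ext (funext fun i => prepend_succ h i)

theorem prepend_shift (y : OneSided A) : prepend (y.1 0) (shift y) = y := by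
  have h : A (y.1 0) ((shift y).1 0) = 1 := y.2 0
  apply Subtype.ext
  funext i
  cases i with
  | zero => exact prepend_zero h
  | succ i => exact prepend_succ h i

/-- Indexing preimages by their first letter pairs the branches over any two points with the same
zeroth symbol, so that their terms can be compared one by one. -/
theorem sum_fiber (x : OneSided A) (f : OneSided A → ℂ) :
    ∑ y ∈ (fiber_finite x).toFinset, f y =
      ∑ a with A a (x.1 0) = 1, f (prepend a x) := by
  symm
  refine Finset.sum_nbij' (fun a => prepend a x) (fun y => y.1 0) ?_ ?_ ?_ ?_ ?_
  · intro a ha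
    simp only [Finset.mem_filter, Finset.mem_univ, true_and] at ha
    simpa using shift_prepend ha
  · intro y hy
    simp only [Set.Finite.mem_toFinset, Set.mem_ofPred_eq] at hy
    subst hy
    exact Finset.mem_filter.2 ⟨Finset.mem_univ _, y.2 0⟩
  · intro a ha
    simp only [Finset.mem_filter, Finset.mem_univ, true_and] at ha
    exact prepend_zero ha
  · intro y hy
    simp only [Set.Finite.mem_toFinset, Set.mem_ofPred_eq] at hy
    subst hy
    exact prepend_shift y
  · intro a _
    rfl

/-! ### The symbolic metric -/

section Metric

variable {lam : ℝ}

theorem symDist_self (x : OneSided A) : symDist lam x x = 0 := by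
  simp [symDist]

theorem symDist_nonneg (h₀ : 0 < lam) (x y : OneSided A) : 0 ≤ symDist lam x y := by
  unfold symDist
  split_ifs <;> positivity

theorem symDist_pos (h₀ : 0 < lam) {x y : OneSided A} (h : x ≠ y) : 0 < symDist lam x y := by
  unfold symDist
  rw [if_neg h]
  positivity

theorem symDist_le_pow (h₀ : 0 < lam) (h₁ : lam < 1) {x y : OneSided A} {n : ℕ}
    (h : ∀ i < n, x.1 i = y.1 i) : symDist lam x y ≤ lam ^ n := by
  unfold symDist
  split_ifs with hxy
  · positivity
  · refine pow_le_pow_of_le_one h₀.le h₁.le (le_csInf ?_ ?_)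
    · by_contra hne
      rw [Set.not_nonempty_iff_eq_empty, Set.eq_empty_iff_forall_notMem] at hne
      exact hxy (Subtype.ext (funext fun i => by simpa using hne i))
    · intro i hi
      by_contra hlt
      exact hi (h i (not_le.1 hlt))

theorem symDist_le_one (h₀ : 0 < lam) (h₁ : lam < 1) (x y : OneSided A) :
    symDist lam x y ≤ 1 := by
  simpa using symDist_le_pow (n := 0) h₀ h₁ (x := x) (y := y) (by simp)

theorem symDist_eq_one {x y : OneSided A} (h : x.1 0 ≠ y.1 0) : symDist lam x y = 1 := by
  have hxy : x ≠ y := fun e => h (by rw [e])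
  have : sInf {i : ℕ | x.1 i ≠ y.1 i} = 0 := Nat.sInf_eq_zero.2 (Or.inl h)
  simp [symDist, hxy, this]

theorem symDist_prepend_le (h₀ : 0 < lam) (h₁ : lam < 1) {a : Fin N} {x y : OneSided A}
    (hx : A a (x.1 0) = 1) (hy : A a (y.1 0) = 1) :
    symDist lam (prepend a x) (prepend a y) ≤ lam * symDist lam x y := by
  by_cases hxy : x = y
  · simp [hxy, symDist_self]
  · have : symDist lam x y = lam ^ sInf {i : ℕ | x.1 i ≠ y.1 i} := by simp [symDist, hxy]
    rw [this, ← pow_succ']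
    refine symDist_le_pow h₀ h₁ fun i hi => ?_
    cases i with
    | zero => rw [prepend_zero hx, prepend_zero hy]
    | succ i =>
      rw [prepend_succ hx, prepend_succ hy]
      by_contra hne
      exact Nat.notMem_of_lt_sInf (Nat.lt_of_succ_lt_succ hi) hne

end Metric

/-! ### Density of preimages -/

/-- If `(Aᵐ)ᵢⱼ > 0` then every point of the cylinder `[j]` has an `m`-th preimage in `[i]`. -/
theorem exists_preimage_of_pow_pos (hA : IsZeroOne A) (m : ℕ) (i : Fin N) (x : OneSided A)
    (h : 0 < (A ^ m) i (x.1 0)) : ∃ y : OneSided A, shift^[m] y = x ∧ y.1 0 = i := by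
  induction m generalizing i with
  | zero =>
    refine ⟨x, rfl, ?_⟩
    by_contra hne
    simp [Ne.symm hne] at h
  | succ m ih =>
    rw [pow_succ', Matrix.mul_apply] at h
    obtain ⟨k, -, hk⟩ := Finset.exists_ne_zero_of_sum_ne_zero h.ne'
    obtain ⟨y, hy, hy0⟩ := ih k (Nat.pos_of_ne_zero (right_ne_zero_of_mul hk))
    have hik : A i (y.1 0) = 1 := by
      rw [hy0]
      exact (hA i k).resolve_left (left_ne_zero_of_mul hk)
    exact ⟨prepend i y, by rw [Function.iterate_succ_apply, shift_prepend hik, hy],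
      prepend_zero hik⟩

/-- The `n`-th preimages of a point are dense at scale `λ ^ n`. -/
theorem exists_preimage_agree (hA : IsZeroOne A) {m : ℕ} (hm : ∀ i j, 0 < (A ^ m) i j)
    (k : ℕ) (x z : OneSided A) :
    ∃ y : OneSided A, shift^[m + k] y = x ∧ ∀ i ≤ k, y.1 i = z.1 i := by
  induction k generalizing z with
  | zero =>
    obtain ⟨y, hy, hy0⟩ := exists_preimage_of_pow_pos hA m (z.1 0) x (hm _ _)
    exact ⟨y, hy, fun i hi => by rw [Nat.le_zero.1 hi, hy0]⟩
  | succ k ih =>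
    obtain ⟨y, hy, hyz⟩ := ih (shift z)
    have h : A (z.1 0) (y.1 0) = 1 := by
      rw [hyz 0 (Nat.zero_le k)]
      exact z.2 0
    refine ⟨prepend (z.1 0) y, ?_, fun i hi => ?_⟩
    · rw [← add_assoc, Function.iterate_succ_apply, shift_prepend h, hy]
    · cases i with
      | zero => exact prepend_zero h
      | succ i => rw [prepend_succ h, hyz i (by omega)]; rfl

/-- `h` is bounded by `M` and Lipschitz with constant `K`. -/
def BoundedLip (lam M K : ℝ) (h : OneSided A → ℂ) : Prop :=
  (∀ x, ‖h x‖ ≤ M) ∧ ∀ x y, ‖h x - h y‖ ≤ K * symDist lam x y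

/-! ### Twisted averages of nearly maximal modulus -/

section Transfer

variable {φ r : OneSided A → ℝ} {b : ℝ}

theorem norm_exp_twist (y : OneSided A) :
    ‖Complex.exp ((φ y : ℂ) + Complex.I * (b : ℂ) * (r y : ℂ))‖ = Real.exp (φ y) := by
  rw [Complex.norm_exp]
  simp

theorem exp_twist (y : OneSided A) :
    Complex.exp ((φ y : ℂ) + Complex.I * (b : ℂ) * (r y : ℂ)) =
      (Real.exp (φ y) : ℂ) * Complex.exp (Complex.I * (b : ℂ) * (r y : ℂ)) := by
  rw [Complex.exp_add, Complex.ofReal_exp]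

theorem norm_exp_I_mul (b s : ℝ) : ‖Complex.exp (Complex.I * (b : ℂ) * (s : ℂ))‖ = 1 := by
  rw [Complex.norm_exp]
  simp

theorem IsNormalized.sum_eq_one (hφ : IsNormalized φ) (x : OneSided A) :
    ∑ a with A a (x.1 0) = 1, Real.exp (φ (prepend a x)) = 1 := by
  have h := congrFun hφ x
  simp only [transfer, mul_one] at h
  rw [sum_fiber] at h
  exact_mod_cast h

theorem twisted_apply (h : OneSided A → ℂ) (x : OneSided A) :
    twisted φ r b h x = ∑ a with A a (x.1 0) = 1,
      Complex.exp ((φ (prepend a x) : ℂ) + Complex.I * (b : ℂ) * (r (prepend a x) : ℂ)) *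
        h (prepend a x) :=
  sum_fiber x _

theorem twisted_smul (c : ℂ) (h : OneSided A → ℂ) :
    twisted φ r b (fun x => c * h x) = fun x => c * twisted φ r b h x := by
  funext x
  simp only [twisted_apply, Finset.mul_sum]
  exact Finset.sum_congr rfl fun a _ => by ring

theorem twisted_iterate_smul (c : ℂ) (h : OneSided A → ℂ) (n : ℕ) :
    (twisted φ r b)^[n] (fun x => c * h x) = fun x => c * (twisted φ r b)^[n] h x := by
  induction n generalizing h with
  | zero => rfl
  | succ n ih => rw [Function.iterate_succ_apply, Function.iterate_succ_apply, twisted_smul, ih]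

theorem norm_twisted_le (hφ : IsNormalized φ) {h : OneSided A → ℂ} {M : ℝ}
    (hM : ∀ x, ‖h x‖ ≤ M) (x : OneSided A) : ‖twisted φ r b h x‖ ≤ M := by
  rw [twisted_apply]
  calc _ ≤ ∑ a with A a (x.1 0) = 1, Real.exp (φ (prepend a x)) * M := by
        refine (norm_sum_le _ _).trans (Finset.sum_le_sum fun a _ => ?_)
        rw [norm_mul, norm_exp_twist]
        exact mul_le_mul_of_nonneg_left (hM _) (Real.exp_pos _).le
    _ = M := by rw [← Finset.sum_mul, hφ.sum_eq_one, one_mul]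

theorem norm_twisted_iterate_le (hφ : IsNormalized φ) {h : OneSided A → ℂ} {M : ℝ}
    (hM : ∀ x, ‖h x‖ ≤ M) (n : ℕ) (x : OneSided A) : ‖(twisted φ r b)^[n] h x‖ ≤ M := by
  induction n generalizing h with
  | zero => exact hM x
  | succ n ih => exact ih (norm_twisted_le hφ hM)

/-- If an average `V = ∑ pᵢ vᵢ` of vectors of the unit disc has modulus at least `1 - ε`, then
each `vᵢ` has modulus at least `1 - ε / pᵢ` and satisfies `|vᵢ - V|² ≤ 2 ε / pᵢ`. -/
theorem average_near_circle {ι : Type*} (s : Finset ι) (p : ι → ℝ) (v : ι → ℂ)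
    (hp : ∀ i ∈ s, 0 ≤ p i) (hsum : ∑ i ∈ s, p i = 1) (hv : ∀ i ∈ s, ‖v i‖ ≤ 1) {ε : ℝ}
    (hV : 1 - ε ≤ ‖∑ i ∈ s, (p i : ℂ) * v i‖) {i : ι} (hi : i ∈ s) :
    p i * (1 - ‖v i‖) ≤ ε ∧ p i * ‖v i - ∑ j ∈ s, (p j : ℂ) * v j‖ ^ 2 ≤ 2 * ε := by
  set V := ∑ j ∈ s, (p j : ℂ) * v j with hVdef
  have hnorm : ‖V‖ ≤ ∑ j ∈ s, p j * ‖v j‖ := by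
    refine (norm_sum_le _ _).trans (Finset.sum_le_sum fun j hj => ?_)
    rw [norm_mul, Complex.norm_real, Real.norm_of_nonneg (hp j hj)]
  have hsum1 : ∑ j ∈ s, p j * (1 - ‖v j‖) ≤ ε := by
    simp only [mul_sub, mul_one, Finset.sum_sub_distrib, hsum]
    linarith
  have hV1 : ‖V‖ ≤ 1 := by
    refine hnorm.trans (hsum ▸ Finset.sum_le_sum fun j hj => ?_)
    nlinarith [hp j hj, hv j hj]
  have hε : 0 ≤ ε := by
    refine le_trans (Finset.sum_nonneg fun j hj => ?_) hsum1
    exact mul_nonneg (hp j hj) (sub_nonneg.2 (hv j hj))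
  refine ⟨le_trans (Finset.single_le_sum (f := fun j => p j * (1 - ‖v j‖))
    (fun j hj => mul_nonneg (hp j hj) (sub_nonneg.2 (hv j hj))) hi) hsum1, ?_⟩
  -- The variance about the mean `V`; it is at most `1 - |V|²`, hence at most `2ε`.
  have hre : ∑ j ∈ s, p j * ‖v j - V‖ ^ 2 = ∑ j ∈ s, p j * ‖v j‖ ^ 2 - ‖V‖ ^ 2 := by
    have key : ∀ j, p j * ‖v j - V‖ ^ 2 =
        p j * ‖v j‖ ^ 2 - 2 * ((p j * (v j).re) * V.re + (p j * (v j).im) * V.im) +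
          p j * ‖V‖ ^ 2 := fun j => by
      simp only [Complex.sq_norm, Complex.normSq_apply, Complex.sub_re, Complex.sub_im]
      ring
    have h1 : ∑ j ∈ s, p j * (v j).re = V.re := by
      simp [hVdef, Complex.re_sum]
    have h2 : ∑ j ∈ s, p j * (v j).im = V.im := by
      simp [hVdef, Complex.im_sum]
    simp only [key, Finset.sum_add_distrib, Finset.sum_sub_distrib, ← Finset.mul_sum,
      ← Finset.sum_mul, h1, h2, hsum]
    simp only [Complex.sq_norm, Complex.normSq_apply]
    ring
  have hle : ∑ j ∈ s, p j * ‖v j‖ ^ 2 ≤ 1 := by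
    refine hsum ▸ Finset.sum_le_sum fun j hj => ?_
    have := pow_le_one₀ (n := 2) (norm_nonneg (v j)) (hv j hj)
    nlinarith [hp j hj]
  have hfin : ∑ j ∈ s, p j * ‖v j - V‖ ^ 2 ≤ 2 * ε := by
    rw [hre]
    by_cases h1 : ε ≤ 1
    · nlinarith [norm_nonneg V]
    · nlinarith [norm_nonneg V]
  exact le_trans (Finset.single_le_sum (f := fun j => p j * ‖v j - V‖ ^ 2)
    (fun j hj => mul_nonneg (hp j hj) (sq_nonneg _)) hi) hfin

/-- If `|𝓛_b h| ≥ 1 - ε` at `σ y` and `|h| ≤ 1`, then `|h(y)|` is near one and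
`e^{ibr(y)} h(y)` is near `𝓛_b h (σ y)`. -/
theorem twisted_near_circle (hφ : IsNormalized φ) {q : ℝ} (hq : ∀ x, -q ≤ φ x)
    {h : OneSided A → ℂ} (h1 : ∀ x, ‖h x‖ ≤ 1) {ε : ℝ} (y : OneSided A)
    (hV : 1 - ε ≤ ‖twisted φ r b h (shift y)‖) :
    1 - ε * Real.exp q ≤ ‖h y‖ ∧
      ‖Complex.exp (Complex.I * (b : ℂ) * (r y : ℂ)) * h y - twisted φ r b h (shift y)‖ ≤
        Real.sqrt (2 * (ε * Real.exp q)) := by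
  have hw : twisted φ r b h (shift y) = ∑ a with A a ((shift y).1 0) = 1,
      (Real.exp (φ (prepend a (shift y))) : ℂ) *
        (Complex.exp (Complex.I * (b : ℂ) * (r (prepend a (shift y)) : ℂ)) *
          h (prepend a (shift y))) := by
    rw [twisted_apply]
    exact Finset.sum_congr rfl fun a _ => by rw [exp_twist, mul_assoc]
  have hmem : y.1 0 ∈ Finset.univ.filter fun a => A a ((shift y).1 0) = 1 :=
    Finset.mem_filter.2 ⟨Finset.mem_univ _, y.2 0⟩
  rw [hw] at hV ⊢
  obtain ⟨e1, e2⟩ := average_near_circle _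
    (fun a => Real.exp (φ (prepend a (shift y)))) _ (fun _ _ => (Real.exp_pos _).le)
    (hφ.sum_eq_one (shift y)) (fun a _ => by
      rw [norm_mul, norm_exp_I_mul, one_mul]
      exact h1 _) hV hmem
  rw [prepend_shift] at e1 e2
  rw [norm_mul, norm_exp_I_mul, one_mul] at e1
  -- Each weight is at least `e^{-q}`, so a bound on one weighted term costs a factor `e^q`.
  have hpq : ∀ t e : ℝ, 0 ≤ t → Real.exp (φ y) * t ≤ e → t ≤ e * Real.exp q := by
    intro t e ht hte
    have h2 : Real.exp (-q) * t ≤ e :=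
      (mul_le_mul_of_nonneg_right (Real.exp_le_exp.2 (hq y)) ht).trans hte
    calc t = (Real.exp (-q) * t) * Real.exp q := by
          rw [mul_right_comm, ← Real.exp_add]
          simp
      _ ≤ e * Real.exp q := mul_le_mul_of_nonneg_right h2 (Real.exp_pos q).le
  refine ⟨?_, Real.le_sqrt_of_sq_le ?_⟩
  · linarith [hpq _ _ (sub_nonneg.2 (h1 y)) e1]
  · rw [← mul_assoc]
    exact hpq _ _ (sq_nonneg _) e2

/-- Each step back along the orbit multiplies the deficit `ε` by at most `e^q`. -/
theorem norm_ge_of_iterate (hφ : IsNormalized φ) {q : ℝ} (hq : ∀ x, -q ≤ φ x)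
    {h : OneSided A → ℂ} (h1 : ∀ x, ‖h x‖ ≤ 1) {ε : ℝ} (n : ℕ) (y : OneSided A)
    (hV : 1 - ε ≤ ‖(twisted φ r b)^[n] h (shift^[n] y)‖) :
    1 - ε * Real.exp (q * n) ≤ ‖h y‖ := by
  induction n generalizing h y with
  | zero => simpa using hV
  | succ n ih =>
    have h2 := ih (norm_twisted_le (r := r) (b := b) hφ h1) (shift y) hV
    have h3 := (twisted_near_circle hφ hq h1 y h2).1
    rwa [mul_assoc, ← Real.exp_add, show q * n + q = q * ((n + 1 : ℕ) : ℝ) by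
      push_cast; ring] at h3

/-- If `|𝓛_bⁿ h| ≥ 1 - η` everywhere and `|h| ≤ 1`, then `e^{ibr_n} h` is near `𝓛_bⁿ h ∘ σⁿ`. -/
theorem iterate_near (hφ : IsNormalized φ) {q : ℝ} (hq₀ : 0 ≤ q) (hq : ∀ x, -q ≤ φ x)
    {h : OneSided A → ℂ} (h1 : ∀ x, ‖h x‖ ≤ 1) {η : ℝ} (hη : 0 ≤ η) (n : ℕ)
    (hV : ∀ x, 1 - η ≤ ‖(twisted φ r b)^[n] h x‖) (y : OneSided A) :
    ‖Complex.exp (Complex.I * (b : ℂ) * ((birkhoffSum shift r n y : ℝ) : ℂ)) * h y -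
      (twisted φ r b)^[n] h (shift^[n] y)‖ ≤ n * Real.sqrt (2 * (η * Real.exp (q * n))) := by
  induction n generalizing h y with
  | zero => simp [birkhoffSum]
  | succ n ih =>
    have h1' := norm_twisted_le (r := r) (b := b) hφ h1
    have e1 := ih h1' hV (shift y)
    have h2 := norm_ge_of_iterate (r := r) (b := b) hφ hq h1' n (shift y) (hV _)
    have e2 := (twisted_near_circle hφ hq h1 y h2).2
    have e3 : Real.sqrt (2 * (η * Real.exp (q * n))) ≤
        Real.sqrt (2 * (η * Real.exp (q * (n + 1 : ℕ)))) := by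
      apply Real.sqrt_le_sqrt
      gcongr
      simp
    rw [mul_assoc η, ← Real.exp_add, show q * n + q = q * ((n + 1 : ℕ) : ℝ) by
      push_cast; ring] at e2
    have e4 : Complex.exp (Complex.I * (b : ℂ) * ((birkhoffSum shift r (n + 1) y : ℝ) : ℂ)) =
        Complex.exp (Complex.I * (b : ℂ) * ((birkhoffSum shift r n (shift y) : ℝ) : ℂ)) *
          Complex.exp (Complex.I * (b : ℂ) * (r y : ℂ)) := by
      rw [← Complex.exp_add, birkhoffSum_succ']
      push_cast
      ring_nf
    rw [e4, Function.iterate_succ_apply, Function.iterate_succ_apply]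
    set E := Complex.exp (Complex.I * (b : ℂ) * ((birkhoffSum shift r n (shift y) : ℝ) : ℂ))
    set F := Complex.exp (Complex.I * (b : ℂ) * (r y : ℂ))
    set T := twisted φ r b h (shift y)
    have hE : ‖E‖ = 1 := norm_exp_I_mul _ _
    calc _ = ‖E * (F * h y - T) + (E * T - (twisted φ r b)^[n] (twisted φ r b h)
            (shift^[n] (shift y)))‖ := by congr 1; ring
      _ ≤ _ := norm_add_le _ _
      _ ≤ Real.sqrt (2 * (η * Real.exp (q * (n + 1 : ℕ)))) +
          n * Real.sqrt (2 * (η * Real.exp (q * (n + 1 : ℕ)))) := by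
        rw [norm_mul, hE, one_mul]
        exact add_le_add e2 (e1.trans (mul_le_mul_of_nonneg_left e3 (Nat.cast_nonneg n)))
      _ = _ := by push_cast; ring

end Transfer

/-! ### The Lasota–Yorke inequality and the norm `‖·‖_b` -/

section LasotaYorke

variable {φ r : OneSided A → ℝ} {b lam : ℝ}

theorem IsLip.exists_pos {E : Type} [NormedAddCommGroup E] {h : OneSided A → E}
    (h₀ : 0 < lam) (hh : IsLip lam h) :
    ∃ K : ℝ, 0 < K ∧ ∀ x y, ‖h x - h y‖ ≤ K * symDist lam x y := by
  obtain ⟨K, hK⟩ := hh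
  exact ⟨max K 1, by positivity, fun x y => (hK x y).trans
    (mul_le_mul_of_nonneg_right (le_max_left _ _) (symDist_nonneg h₀ _ _))⟩

theorem IsNormalized.nonpos (hφ : IsNormalized φ) (y : OneSided A) : φ y ≤ 0 := by
  rw [← Real.exp_le_one_iff, ← hφ.sum_eq_one (shift y)]
  have hmem : y.1 0 ∈ Finset.univ.filter fun a => A a ((shift y).1 0) = 1 :=
    Finset.mem_filter.2 ⟨Finset.mem_univ _, y.2 0⟩
  have := Finset.single_le_sum (f := fun a => Real.exp (φ (prepend a (shift y))))
    (fun a _ => (Real.exp_pos _).le) hmem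
  simpa only [prepend_shift] using this

theorem norm_exp_I_mul_sub_le (b s t : ℝ) :
    ‖Complex.exp (Complex.I * (b : ℂ) * (s : ℂ)) - Complex.exp (Complex.I * (b : ℂ) * (t : ℂ))‖ ≤
      |b| * |s - t| := by
  have e : Complex.exp (Complex.I * (b : ℂ) * (s : ℂ)) -
      Complex.exp (Complex.I * (b : ℂ) * (t : ℂ)) =
      Complex.exp (Complex.I * (b : ℂ) * (t : ℂ)) *
        (Complex.exp (Complex.I * ((b * (s - t) : ℝ) : ℂ)) - 1) := by
    rw [mul_sub, ← Complex.exp_add, mul_one]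
    push_cast
    ring_nf
  rw [e, norm_mul, norm_exp_I_mul, one_mul, ← abs_mul]
  exact Real.norm_exp_I_mul_ofReal_sub_one_le

theorem abs_exp_sub_exp_le {u v : ℝ} (hu : u ≤ 0) (hv : v ≤ 0) :
    |Real.exp u - Real.exp v| ≤ |u - v| := by
  wlog h : v ≤ u generalizing u v
  · rw [abs_sub_comm, abs_sub_comm u]
    exact this hv hu (le_of_not_ge h)
  rw [abs_of_nonneg (sub_nonneg.2 (Real.exp_le_exp.2 h)), abs_of_nonneg (sub_nonneg.2 h)]
  have h1 : Real.exp v = Real.exp u * Real.exp (v - u) := by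
    rw [← Real.exp_add]
    ring_nf
  have h2 := Real.add_one_le_exp (v - u)
  have h3 := Real.exp_le_one_iff.2 hu
  have h4 := Real.exp_le_one_iff.2 (sub_nonpos.2 h)
  rw [h1]
  nlinarith [Real.exp_pos u]

/-- The Lasota-Yorke inequality for one step of the twisted transfer operator. -/
theorem BoundedLip.twisted (h₀ : 0 < lam) (h₁ : lam < 1) (hφ : IsNormalized φ) {Kφ Kr : ℝ}
    (hKφ₀ : 0 ≤ Kφ) (hKr₀ : 0 ≤ Kr) (hKφ : ∀ x y, ‖φ x - φ y‖ ≤ Kφ * symDist lam x y)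
    (hKr : ∀ x y, ‖r x - r y‖ ≤ Kr * symDist lam x y) (hb : 1 ≤ |b|) {M K : ℝ} (hM : 0 ≤ M)
    (hK : 0 ≤ K) {h : OneSided A → ℂ} (hh : BoundedLip lam M K h) :
    BoundedLip lam M (lam * K + (N * (Kφ + Kr) + 2) * |b| * M) (twisted φ r b h) := by
  refine ⟨norm_twisted_le hφ hh.1, fun x y => ?_⟩
  have hcM : 0 ≤ (N * (Kφ + Kr)) * |b| * M := by positivity
  have hd := symDist_nonneg h₀ x y
  -- Points with different zeroth symbols have unmatched branches, but their distance is 1, and the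
  -- trivial bound `2M ≤ 2|b|M` accounts for the summand 2 in the constant.
  by_cases hxy : x.1 0 = y.1 0
  swap
  · rw [symDist_eq_one hxy, mul_one]
    have e1 := norm_twisted_le (r := r) (b := b) hφ hh.1 x
    have e2 := norm_twisted_le (r := r) (b := b) hφ hh.1 y
    have e3 := norm_sub_le (Subshift.twisted φ r b h x) (Subshift.twisted φ r b h y)
    have e4 : 0 ≤ lam * K := by positivity
    nlinarith
  set d := symDist lam x y
  have hterm : ∀ a ∈ Finset.univ.filter fun a => A a (x.1 0) = 1,
      ‖Complex.exp ((φ (prepend a x) : ℂ) + Complex.I * (b : ℂ) * (r (prepend a x) : ℂ)) *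
        h (prepend a x) -
       Complex.exp ((φ (prepend a y) : ℂ) + Complex.I * (b : ℂ) * (r (prepend a y) : ℂ)) *
        h (prepend a y)‖ ≤
      Real.exp (φ (prepend a x)) * (lam * K * d) + (Kφ + Kr) * |b| * M * d := by
    intro a ha
    have hax : A a (x.1 0) = 1 := (Finset.mem_filter.1 ha).2
    have hay : A a (y.1 0) = 1 := hxy ▸ hax
    have hpd := symDist_prepend_le h₀ h₁ hax hay
    have hpd' : symDist lam (prepend a x) (prepend a y) ≤ d :=
      hpd.trans (mul_le_of_le_one_left hd h₁.le)
    set u := prepend a x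
    set v := prepend a y
    have hexp : ‖Complex.exp ((φ u : ℂ) + Complex.I * (b : ℂ) * (r u : ℂ)) -
        Complex.exp ((φ v : ℂ) + Complex.I * (b : ℂ) * (r v : ℂ))‖ ≤ (Kφ + Kr) * |b| * d := by
      rw [exp_twist, exp_twist]
      set E := Complex.exp (Complex.I * (b : ℂ) * (r u : ℂ))
      set F := Complex.exp (Complex.I * (b : ℂ) * (r v : ℂ))
      have hF : ‖F‖ = 1 := norm_exp_I_mul _ _
      have hEF : ‖E - F‖ ≤ |b| * |r u - r v| := norm_exp_I_mul_sub_le _ _ _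
      have hp := abs_exp_sub_exp_le (hφ.nonpos u) (hφ.nonpos v)
      have k1 : |φ u - φ v| ≤ Kφ * d :=
        (hKφ u v).trans (mul_le_mul_of_nonneg_left hpd' hKφ₀)
      have k2 : |r u - r v| ≤ Kr * d :=
        (hKr u v).trans (mul_le_mul_of_nonneg_left hpd' hKr₀)
      calc ‖(Real.exp (φ u) : ℂ) * E - (Real.exp (φ v) : ℂ) * F‖
          = ‖(Real.exp (φ u) : ℂ) * (E - F) +
              ((Real.exp (φ u) - Real.exp (φ v) : ℝ) : ℂ) * F‖ := by
            congr 1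
            push_cast
            ring
        _ ≤ Real.exp (φ u) * ‖E - F‖ + |Real.exp (φ u) - Real.exp (φ v)| := by
            refine (norm_add_le _ _).trans (le_of_eq ?_)
            rw [norm_mul, norm_mul, hF, Complex.norm_real, Complex.norm_real,
              Real.norm_of_nonneg (Real.exp_pos _).le, mul_one, Real.norm_eq_abs]
        _ ≤ 1 * (|b| * (Kr * d)) + Kφ * d := by
            refine add_le_add (mul_le_mul (Real.exp_le_one_iff.2 (hφ.nonpos u)) ?_
              (norm_nonneg _) zero_le_one) (hp.trans k1)
            exact hEF.trans (mul_le_mul_of_nonneg_left k2 (abs_nonneg b))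
        _ ≤ (Kφ + Kr) * |b| * d := by
            have : Kφ * d * 1 ≤ Kφ * d * |b| := mul_le_mul_of_nonneg_left hb (by positivity)
            nlinarith
    set G := Complex.exp ((φ u : ℂ) + Complex.I * (b : ℂ) * (r u : ℂ)) with hG
    set H := Complex.exp ((φ v : ℂ) + Complex.I * (b : ℂ) * (r v : ℂ))
    calc ‖G * h u - H * h v‖ = ‖G * (h u - h v) + (G - H) * h v‖ := by congr 1; ring
      _ ≤ ‖G‖ * ‖h u - h v‖ + ‖G - H‖ * ‖h v‖ := by
          refine (norm_add_le _ _).trans (le_of_eq ?_)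
          rw [norm_mul, norm_mul]
      _ ≤ Real.exp (φ u) * (lam * K * d) + (Kφ + Kr) * |b| * d * M := by
          rw [hG, norm_exp_twist]
          refine add_le_add (mul_le_mul_of_nonneg_left ?_ (Real.exp_pos _).le)
            (mul_le_mul hexp (hh.1 v) (norm_nonneg _) (by positivity))
          calc _ ≤ K * symDist lam u v := hh.2 u v
            _ ≤ K * (lam * d) := mul_le_mul_of_nonneg_left hpd hK
            _ = _ := by ring
      _ = _ := by ring
  rw [twisted_apply, twisted_apply, ← hxy, ← Finset.sum_sub_distrib]
  refine ((norm_sum_le _ _).trans (Finset.sum_le_sum hterm)).trans ?_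
  rw [Finset.sum_add_distrib, ← Finset.sum_mul, hφ.sum_eq_one x, Finset.sum_const, nsmul_eq_mul]
  have hcard : ((Finset.univ.filter fun a => A a (x.1 0) = 1).card : ℝ) ≤ N := by
    exact_mod_cast (Finset.card_filter_le _ _).trans (by simp)
  have := mul_le_mul_of_nonneg_right hcard
    (show 0 ≤ (Kφ + Kr) * |b| * M * d by positivity)
  have h2 : 0 ≤ 2 * |b| * M * d := by positivity
  nlinarith

/-- The choice of `C` makes `C|b|M/2` the fixed point of `K ↦ λK + (N(Kφ + Kr) + 2)|b|M`; starting
from twice that value, the excess decays like `λ^n`. -/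
theorem BoundedLip.twisted_iterate (h₀ : 0 < lam) (h₁ : lam < 1) (hφ : IsNormalized φ)
    {Kφ Kr : ℝ} (hKφ₀ : 0 ≤ Kφ) (hKr₀ : 0 ≤ Kr)
    (hKφ : ∀ x y, ‖φ x - φ y‖ ≤ Kφ * symDist lam x y)
    (hKr : ∀ x y, ‖r x - r y‖ ≤ Kr * symDist lam x y) (hb : 1 ≤ |b|) {M C : ℝ} (hM : 0 ≤ M)
    (hC : 2 * (N * (Kφ + Kr) + 2) = C * (1 - lam)) (hC₀ : 0 ≤ C)
    {h : OneSided A → ℂ} (hh : BoundedLip lam M (C * |b| * M) h) (n : ℕ) :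
    BoundedLip lam M (C * |b| * M * ((1 + lam ^ n) / 2)) ((Subshift.twisted φ r b)^[n] h) := by
  induction n with
  | zero => simpa using hh
  | succ n ih =>
    rw [Function.iterate_succ_apply']
    have h2 := ih.twisted h₀ h₁ hφ hKφ₀ hKr₀ hKφ hKr hb hM (by positivity)
    have e : lam * (C * |b| * M * ((1 + lam ^ n) / 2)) + (N * (Kφ + Kr) + 2) * |b| * M =
        C * |b| * M * ((1 + lam ^ (n + 1)) / 2) := by
      rw [show N * (Kφ + Kr) + 2 = C * (1 - lam) / 2 by linarith, pow_succ]
      ring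
    rwa [e] at h2

theorem BoundedLip.isLip {M K : ℝ} {h : OneSided A → ℂ} (hh : BoundedLip lam M K h) :
    IsLip lam h := ⟨K, hh.2⟩

theorem BoundedLip.mono (h₀ : 0 < lam) {M K K' : ℝ} {h : OneSided A → ℂ}
    (hh : BoundedLip lam M K h) (hK : K ≤ K') : BoundedLip lam M K' h :=
  ⟨hh.1, fun x y => (hh.2 x y).trans
    (mul_le_mul_of_nonneg_right hK (symDist_nonneg h₀ x y))⟩

theorem BoundedLip.bNorm_le [Nonempty (OneSided A)] (h₀ : 0 < lam) {M M' K C : ℝ}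
    (hC : 0 < C * |b|) (hK : 0 ≤ K) {h : OneSided A → ℂ} (hh : BoundedLip lam M K h)
    (hM : M ≤ M') (hK' : K ≤ C * |b| * M') : bNorm lam C b h ≤ M' := by
  refine max_le ((ciSup_le hh.1).trans hM) ?_
  rw [div_le_iff₀ hC, mul_comm M']
  refine le_trans (ciSup_le fun p => ?_) hK'
  by_cases hp : p.1 = p.2
  · simpa [hp] using hK
  · rw [div_le_iff₀ (symDist_pos h₀ hp)]
    exact hh.2 _ _

/-- For a Lipschitz `h` both suprema run over bounded families; a real `⨆` over an unbounded family
would be 0 and control nothing. -/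
theorem IsLip.boundedLip [Nonempty (OneSided A)] (h₀ : 0 < lam) (h₁ : lam < 1) {C : ℝ}
    (hC : 0 < C * |b|) {h : OneSided A → ℂ} (hh : IsLip lam h) :
    BoundedLip lam (bNorm lam C b h) (C * |b| * bNorm lam C b h) h := by
  obtain ⟨K, hK₀, hK⟩ := hh.exists_pos h₀
  obtain ⟨z⟩ := ‹Nonempty (OneSided A)›
  have hbdd : BddAbove (Set.range fun x => ‖h x‖) := by
    refine ⟨K + ‖h z‖, ?_⟩
    rintro _ ⟨x, rfl⟩
    have e1 := norm_le_norm_sub_add (h x) (h z)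
    have e2 := hK x z
    have e3 := mul_le_mul_of_nonneg_left (symDist_le_one h₀ h₁ x z) hK₀.le
    simp only
    linarith
  have hbdd2 : BddAbove (Set.range fun p : OneSided A × OneSided A =>
      ‖h p.1 - h p.2‖ / symDist lam p.1 p.2) := by
    refine ⟨K, ?_⟩
    rintro _ ⟨p, rfl⟩
    by_cases hp : p.1 = p.2
    · simpa [hp] using hK₀.le
    · simp only
      rw [div_le_iff₀ (symDist_pos h₀ hp)]
      exact hK _ _
  refine ⟨fun x => (le_ciSup hbdd x).trans (le_max_left _ _), fun x y => ?_⟩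
  by_cases hp : x = y
  · simp [hp, symDist_self]
  · rw [← div_le_iff₀ (symDist_pos h₀ hp)]
    refine (le_ciSup hbdd2 (x, y)).trans ?_
    rw [← div_le_iff₀' hC]
    exact le_max_right _ _

end LasotaYorke

/-! ### Displacements on the two-sided shift -/

section TwoSided

variable {lam : ℝ} {r : OneSided A → ℝ}

theorem shift_iterate_apply (n : ℕ) (x : OneSided A) (i : ℕ) :
    (shift^[n] x).1 i = x.1 (i + n) := by
  induction n generalizing x with
  | zero => rfl
  | succ n ih =>
    rw [Function.iterate_succ_apply, ih]
    rfl

theorem roofSum_eq (n : ℕ) (x : TwoSided A) : roofSum r n x = birkhoffSum shift r n (proj x) := by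
  have hs : Function.Semiconj (proj (A := A)) (shiftBy 1) shift := fun x =>
    Subtype.ext (funext fun i => by simp [proj, shiftBy, shift])
  simp only [roofSum, birkhoffSum]
  exact Finset.sum_congr rfl fun i _ => congrArg r (hs.iterate_right i x)

theorem shift_iterate_proj_shiftBy (n : ℕ) (x : TwoSided A) :
    shift^[n] (proj (shiftBy (-(n : ℤ)) x)) = proj x := by
  apply Subtype.ext
  funext i
  rw [shift_iterate_apply]
  simp [proj, shiftBy]

theorem shift_iterate_proj_eq {n : ℕ} {x y : TwoSided A} (h : y ∈ stableSet n x) :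
    shift^[n] (proj y) = shift^[n] (proj x) := by
  apply Subtype.ext
  funext i
  rw [shift_iterate_apply, shift_iterate_apply]
  exact h _ (by push_cast; omega)

/-- Both points have the same image under `σ^n`, so all later terms cancel and the sequence defining
the limit is constant from `n` on. -/
theorem deltaS_eq {n : ℕ} {x y : TwoSided A} (h : y ∈ stableSet n x) :
    deltaS r x y = roofSum r n y - roofSum r n x := by
  refine Tendsto.limUnder_eq (tendsto_const_nhds.congr' ?_)
  filter_upwards [eventually_ge_atTop n] with k hk
  obtain ⟨j, rfl⟩ := Nat.exists_eq_add_of_le hk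
  simp only [roofSum_eq, birkhoffSum_add, shift_iterate_proj_eq h]
  ring

theorem symDist_proj_shiftBy_le (h₀ : 0 < lam) (h₁ : lam < 1) {n : ℕ} {x y : TwoSided A}
    (h : y ∈ unstableSet n x) (k : ℕ) :
    symDist lam (proj (shiftBy (-(k : ℤ)) x)) (proj (shiftBy (-(k : ℤ)) y)) ≤
      lam ^ k / lam ^ n := by
  rw [le_div_iff₀ (by positivity)]
  rcases le_total n k with hnk | hnk
  · calc _ ≤ lam ^ (k - n) * lam ^ n := by
          refine mul_le_mul_of_nonneg_right (symDist_le_pow h₀ h₁ fun i hi => ?_) (by positivity)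
          exact (h _ (by omega)).symm
      _ = lam ^ k := by rw [← pow_add, Nat.sub_add_cancel hnk]
  · calc _ ≤ 1 * lam ^ n := mul_le_mul_of_nonneg_right (symDist_le_one h₀ h₁ _ _) (by positivity)
      _ ≤ lam ^ k := by
          rw [one_mul]
          exact pow_le_pow_of_le_one h₀.le h₁.le hnk

/-- Raising `k` by one adds a single difference of values of `r` at points at distance at most
`λ^{k+1-n}`; the bound is the tail of a geometric series. -/
theorem abs_deltaU_sub_le (h₀ : 0 < lam) (h₁ : lam < 1) {K : ℝ} (hK₀ : 0 ≤ K)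
    (hK : ∀ x y, ‖r x - r y‖ ≤ K * symDist lam x y) {n : ℕ} {x y : TwoSided A}
    (h : y ∈ unstableSet n x) (k : ℕ) :
    |deltaU r x y -
      (roofSum r k (shiftBy (-(k : ℤ)) x) - roofSum r k (shiftBy (-(k : ℤ)) y))| ≤
      K / lam ^ n * lam ^ k / (1 - lam) := by
  set f : ℕ → ℝ := fun k =>
    roofSum r k (shiftBy (-(k : ℤ)) x) - roofSum r k (shiftBy (-(k : ℤ)) y) with hf
  have hsh : ∀ (k : ℕ) (x : TwoSided A), shift (proj (shiftBy (-((k + 1 : ℕ) : ℤ)) x)) =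
      proj (shiftBy (-(k : ℤ)) x) := fun k x => Subtype.ext (funext fun i =>
    congrArg x.1 (show ((i + 1 : ℕ) : ℤ) + -((k + 1 : ℕ) : ℤ) = (i : ℤ) + -(k : ℤ) by
      push_cast
      ring))
  have hstep : ∀ k, dist (f k) (f (k + 1)) ≤ K / lam ^ n * lam ^ k := fun k => by
    have e : f (k + 1) - f k = r (proj (shiftBy (-((k + 1 : ℕ) : ℤ)) x)) -
        r (proj (shiftBy (-((k + 1 : ℕ) : ℤ)) y)) := by
      simp only [hf, roofSum_eq, birkhoffSum_succ', hsh]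
      ring
    rw [dist_comm, Real.dist_eq, e]
    calc _ ≤ K * (lam ^ (k + 1) / lam ^ n) :=
          (hK _ _).trans (mul_le_mul_of_nonneg_left (symDist_proj_shiftBy_le h₀ h₁ h _) hK₀)
      _ ≤ K * (lam ^ k / lam ^ n) := by
          gcongr K * (?_ / _)
          exact pow_le_pow_of_le_one h₀.le h₁.le (Nat.le_succ k)
      _ = _ := by ring
  -- Completeness gives an actual limit, so `limUnder` is not a default value.
  have hlim : Tendsto f atTop (𝓝 (deltaU r x y)) :=
    (cauchySeq_of_le_geometric lam _ h₁ hstep).tendsto_limUnder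
  have := dist_le_of_le_geometric_of_tendsto lam _ h₁ hstep hlim k
  rwa [dist_comm, Real.dist_eq] at this

theorem mem_stableSet_comm {n : ℤ} {x y : TwoSided A} (h : y ∈ stableSet n x) :
    x ∈ stableSet n y := fun i hi => (h i hi).symm

theorem mem_unstableSet_comm {n : ℤ} {x y : TwoSided A} (h : y ∈ unstableSet n x) :
    x ∈ unstableSet n y := fun i hi => (h i hi).symm

/-- If `g` is nearly invariant under the stable and unstable holonomies twisted by `e^{ib·}`,
then `b D` is near `2 π ℤ` for the displacement `D` of every quadrilateral. -/
theorem norm_exp_displacement_sub_one_le {g : OneSided A → ℂ} {b δu δs : ℝ} {n : ℕ}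
    (hu : ∀ x y : TwoSided A, y ∈ unstableSet n x →
      ‖Complex.exp (Complex.I * (b : ℂ) * (deltaU r x y : ℂ)) * g (proj y) - g (proj x)‖ ≤ δu)
    (hs : ∀ x y : TwoSided A, y ∈ stableSet n x →
      ‖Complex.exp (Complex.I * (b : ℂ) * (deltaS r x y : ℂ)) * g (proj y) - g (proj x)‖ ≤ δs)
    {w₀ w₁ w₂ w₃ : TwoSided A} (hg : 1 / 2 ≤ ‖g (proj w₀)‖)
    (hw : IsQuadrilateral n w₀ w₁ w₂ w₃) :
    ‖Complex.exp (Complex.I * (b : ℂ) * (displacement r w₀ w₁ w₂ w₃ : ℂ)) - 1‖ ≤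
      4 * (δu + δs) := by
  obtain ⟨h1, h2, h3u, h3s⟩ := hw
  have k1 := hu w₀ w₁ h1
  have k2 := hs w₁ w₃ h3s
  have k3 := hu w₃ w₂ (mem_unstableSet_comm h3u)
  have k4 := hs w₂ w₀ (mem_stableSet_comm h2)
  have hE : Complex.exp (Complex.I * (b : ℂ) * (displacement r w₀ w₁ w₂ w₃ : ℂ)) =
      Complex.exp (Complex.I * (b : ℂ) * (deltaU r w₀ w₁ : ℂ)) *
      (Complex.exp (Complex.I * (b : ℂ) * (deltaS r w₁ w₃ : ℂ)) *
      (Complex.exp (Complex.I * (b : ℂ) * (deltaU r w₃ w₂ : ℂ)) *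
      Complex.exp (Complex.I * (b : ℂ) * (deltaS r w₂ w₀ : ℂ)))) := by
    rw [← Complex.exp_add, ← Complex.exp_add, ← Complex.exp_add, displacement]
    push_cast
    ring_nf
  rw [hE]
  have n1 := norm_exp_I_mul b (deltaU r w₀ w₁)
  have n2 := norm_exp_I_mul b (deltaS r w₁ w₃)
  have n3 := norm_exp_I_mul b (deltaU r w₃ w₂)
  set E1 := Complex.exp (Complex.I * (b : ℂ) * (deltaU r w₀ w₁ : ℂ))
  set E2 := Complex.exp (Complex.I * (b : ℂ) * (deltaS r w₁ w₃ : ℂ))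
  set E3 := Complex.exp (Complex.I * (b : ℂ) * (deltaU r w₃ w₂ : ℂ))
  set E4 := Complex.exp (Complex.I * (b : ℂ) * (deltaS r w₂ w₀ : ℂ))
  set g0 := g (proj w₀)
  set g1 := g (proj w₁)
  set g2 := g (proj w₂)
  set g3 := g (proj w₃)
  -- Telescoping along `w₀ → w₁ → w₃ → w₂ → w₀`, one holonomy error per side; `|g0| ≥ 1/2` then
  -- turns the factor 2 into 4.
  have hprod : ‖E1 * (E2 * (E3 * E4)) - 1‖ * ‖g0‖ ≤ 2 * (δu + δs) := by
    rw [← norm_mul]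
    calc ‖(E1 * (E2 * (E3 * E4)) - 1) * g0‖
        = ‖E1 * (E2 * (E3 * (E4 * g0 - g2))) + E1 * (E2 * (E3 * g2 - g3)) +
            E1 * (E2 * g3 - g1) + (E1 * g1 - g0)‖ := by congr 1; ring
      _ ≤ ‖E1 * (E2 * (E3 * (E4 * g0 - g2)))‖ + ‖E1 * (E2 * (E3 * g2 - g3))‖ +
            ‖E1 * (E2 * g3 - g1)‖ + ‖E1 * g1 - g0‖ := norm_add₄_le
      _ ≤ δs + δu + δs + δu := by
          simp only [norm_mul, n1, n2, n3, one_mul]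
          exact add_le_add (add_le_add (add_le_add k4 k3) k2) k1
      _ = _ := by ring
  nlinarith [norm_nonneg (E1 * (E2 * (E3 * E4)) - 1)]

end TwoSided

/-! ### Choice of the exponents -/

/-- Absorbs a constant factor into a power of `|b|`, with `t = log |b|` bounded below by `t₀`. -/
theorem le_exp_div_mul {t₀ t D : ℝ} (ht₀ : 0 < t₀) (ht : t₀ ≤ t) (hD : 0 ≤ D) :
    D ≤ Real.exp (D / t₀ * t) := by
  have h1 : D ≤ D / t₀ * t := by
    rw [div_mul_eq_mul_div, le_div_iff₀ ht₀]
    exact mul_le_mul_of_nonneg_left ht hD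
  linarith [Real.add_one_le_exp (D / t₀ * t)]

/-- The choice of the exponents in the Dolgopyat type estimate. -/
theorem exists_exponents {t₀ l q C₂ C₃ K c : ℝ} (ht₀ : 0 < t₀) (hl : 0 < l) (hq : 0 ≤ q)
    (hC₂ : 0 < C₂) (hC₃ : 0 < C₃) (hK : 1 ≤ K) (hc : 0 ≤ c) (m N₀ : ℕ) :
    ∃ C₈ C₉ : ℝ, 0 < C₈ ∧ 0 < C₉ ∧ ∀ t : ℝ, t₀ ≤ t → ∃ (k n : ℕ) (η : ℝ),
      N₀ ≤ n ∧ n + N₀ + (m + k) = ⌊C₈ * t⌋₊ ∧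
      Real.exp (-(C₉ * t)) * Real.exp (q * (m + k : ℕ)) + K * Real.exp t * Real.exp (-(l * k)) ≤
        η ∧
      0 ≤ η ∧ η * Real.exp (q * N₀) ≤ 1 / 2 ∧
      16 * (n * Real.sqrt (2 * (η * Real.exp (q * N₀) * Real.exp (q * n)))) +
        c * Real.exp t * Real.exp (-(l * n)) < C₃ * Real.exp (-(C₂ * t)) ∧
      Real.exp (-(C₉ * t)) ≤ 1 / 4 ∧ Real.exp (-(l * ⌊C₈ * t⌋₊)) ≤ 1 / 4 := by
  -- The order of choice matters: `a t ≤ n ≤ a₁ t` makes `λ^n` beat `|b|^{1+C₂}`; `P` fixes `η =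
  -- e^{-2Pt}/2`, small enough to survive the loss `e^{qn}` under the square root; `k ≥ a₂ t` makes
  -- `K|b|λ^k` smaller than `η`; `C₈` leaves room for all the blocks; `C₉` comes last because it
  -- must absorb `e^{q(m+k)} ≤ e^{qC₈t}`. Fixed constants enter divided by `t₀`.
  obtain ⟨a, ha⟩ : ∃ x, x = (4 * c / C₃ / t₀ + 1 + C₂) / l + N₀ / t₀ := ⟨_, rfl⟩
  obtain ⟨a₁, ha₁⟩ : ∃ x, x = a + 1 / t₀ := ⟨_, rfl⟩
  obtain ⟨P, hP⟩ : ∃ x, x = 64 / C₃ / t₀ + a₁ + q * a₁ + C₂ := ⟨_, rfl⟩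
  obtain ⟨a₂, ha₂⟩ : ∃ x, x = (4 * K / t₀ + 1 + 2 * P) / l := ⟨_, rfl⟩
  obtain ⟨C₈, hC₈⟩ : ∃ x, x = a₂ + a₁ + (1 + m + N₀) / t₀ := ⟨_, rfl⟩
  obtain ⟨C₉, hC₉⟩ : ∃ x, x = 4 / t₀ + q * C₈ + 2 * P := ⟨_, rfl⟩
  have hK0 : 0 < K := by linarith
  have ha0 : 0 < a := by rw [ha]; positivity
  have ha₁0 : 0 < a₁ := by rw [ha₁]; positivity
  have hP0 : 0 < P := by rw [hP]; positivity
  have ha₂0 : 0 < a₂ := by rw [ha₂]; positivity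
  have hC₈0 : 0 < C₈ := by rw [hC₈]; positivity
  have hC₉0 : 0 < C₉ := by rw [hC₉]; positivity
  refine ⟨C₈, C₉, hC₈0, hC₉0, fun t ht => ?_⟩
  have ht0 : 0 < t := ht₀.trans_le ht
  have hdiv : ∀ D : ℝ, 0 ≤ D → D ≤ D / t₀ * t := fun D hD => by
    rw [div_mul_eq_mul_div, le_div_iff₀ ht₀]
    exact mul_le_mul_of_nonneg_left ht hD
  obtain ⟨n, hn⟩ : ∃ n, n = ⌈a * t⌉₊ := ⟨_, rfl⟩
  have hn1 : a * t ≤ n := hn ▸ Nat.le_ceil _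
  have hn2 : (n : ℝ) ≤ a₁ * t := by
    have := (Nat.ceil_lt_add_one (show 0 ≤ a * t by positivity)).le
    rw [← hn] at this
    have h1 := hdiv 1 zero_le_one
    rw [ha₁, add_mul]
    linarith
  have hN₀n : (N₀ : ℝ) ≤ n := by
    refine le_trans ?_ hn1
    have h1 := hdiv N₀ (Nat.cast_nonneg _)
    have h2 : 0 ≤ (4 * c / C₃ / t₀ + 1 + C₂) / l * t := by positivity
    rw [ha, add_mul]
    linarith
  have hC₈t : C₈ * t = a₂ * t + a₁ * t + (1 + m + N₀) / t₀ * t := by rw [hC₈]; ring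
  have hmN := hdiv (1 + m + N₀) (by positivity)
  have hfl := Nat.lt_floor_add_one (C₈ * t)
  have hfl' := Nat.floor_le (show 0 ≤ C₈ * t by positivity)
  have hle : n + N₀ + m ≤ ⌊C₈ * t⌋₊ := by
    have : ((n + N₀ + m : ℕ) : ℝ) < (⌊C₈ * t⌋₊ : ℝ) + 1 := by
      push_cast
      have : 0 ≤ a₂ * t := by positivity
      linarith
    exact_mod_cast Nat.lt_succ_iff.1 (by exact_mod_cast this)
  obtain ⟨k, hk⟩ := Nat.exists_eq_add_of_le hle
  have hkR : (⌊C₈ * t⌋₊ : ℝ) = n + N₀ + m + k := by exact_mod_cast hk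
  have hk1 : a₂ * t ≤ k := by linarith
  have hmk : ((m + k : ℕ) : ℝ) ≤ C₈ * t := by
    push_cast
    have : (0 : ℝ) ≤ n + N₀ := by positivity
    linarith
  have hla₂ : l * a₂ = 4 * K / t₀ + 1 + 2 * P := by rw [ha₂]; field_simp
  have hη2 : K * Real.exp t * Real.exp (-(l * k)) ≤ Real.exp (-(2 * P * t)) / 4 := by
    have e1 := le_exp_div_mul ht₀ ht (show 0 ≤ 4 * K by positivity)
    calc K * Real.exp t * Real.exp (-(l * k))
        = 4 * K * (Real.exp t * Real.exp (-(l * k))) / 4 := by ring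
      _ ≤ Real.exp (4 * K / t₀ * t) * (Real.exp t * Real.exp (-(l * k))) / 4 := by gcongr
      _ ≤ _ := by
        rw [← Real.exp_add, ← Real.exp_add]
        gcongr
        have : l * a₂ * t ≤ l * k := by
          rw [mul_assoc]
          exact mul_le_mul_of_nonneg_left hk1 hl.le
        rw [hla₂] at this
        linarith
  have h4 : 4 * Real.exp (-(C₉ * t)) ≤ Real.exp (-(q * (C₈ * t)) - 2 * P * t) := by
    have e1 := le_exp_div_mul ht₀ ht (show (0 : ℝ) ≤ 4 by norm_num)
    calc 4 * Real.exp (-(C₉ * t)) ≤ Real.exp (4 / t₀ * t) * Real.exp (-(C₉ * t)) := by gcongr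
      _ ≤ _ := by
        rw [← Real.exp_add, hC₉]
        gcongr
        linarith
  have hη1 : Real.exp (-(C₉ * t)) * Real.exp (q * (m + k : ℕ)) ≤ Real.exp (-(2 * P * t)) / 4 := by
    have e1 : Real.exp (q * (m + k : ℕ)) ≤ Real.exp (q * (C₈ * t)) := by gcongr
    have e2 : Real.exp (-(q * (C₈ * t)) - 2 * P * t) * Real.exp (q * (C₈ * t)) =
        Real.exp (-(2 * P * t)) := by
      rw [← Real.exp_add]
      ring_nf
    have e3 := mul_le_mul h4 e1 (Real.exp_pos _).le (Real.exp_pos _).le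
    rw [e2] at e3
    linarith
  have hsmall : 2 * (Real.exp (-(2 * P * t)) / 2 * Real.exp (q * N₀) * Real.exp (q * n)) ≤
      Real.exp (-((P - q * a₁) * t)) ^ 2 := by
    rw [← Real.exp_nat_mul]
    calc _ = Real.exp (-(2 * P * t) + q * N₀ + q * n) := by
          rw [Real.exp_add, Real.exp_add]
          ring
      _ ≤ _ := by
          gcongr
          have e1 : q * N₀ ≤ q * (a₁ * t) := mul_le_mul_of_nonneg_left (hN₀n.trans hn2) hq
          have e2 : q * n ≤ q * (a₁ * t) := mul_le_mul_of_nonneg_left hn2 hq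
          push_cast
          linarith
  have hexp_le : ∀ s : ℝ, 0 ≤ s → Real.exp (-s) ≤ 1 := fun s hs =>
    Real.exp_le_one_iff.2 (by linarith)
  have hPq : 0 ≤ (P - q * a₁) * t := by
    have : 0 ≤ 64 / C₃ / t₀ + a₁ + C₂ := by positivity
    exact mul_nonneg (by linarith) ht0.le
  refine ⟨k, n, Real.exp (-(2 * P * t)) / 2, by exact_mod_cast hN₀n, by omega, by linarith,
    by positivity, ?_, ?_, ?_, ?_⟩
  · have e1 : Real.exp (-((P - q * a₁) * t)) ^ 2 ≤ 1 := pow_le_one₀ (Real.exp_pos _).le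
      (hexp_le _ hPq)
    have e2 : 1 ≤ Real.exp (q * n) := Real.one_le_exp (by positivity)
    have e3 : 0 ≤ Real.exp (-(2 * P * t)) / 2 * Real.exp (q * N₀) := by positivity
    nlinarith
  · have e1 : Real.sqrt (2 * (Real.exp (-(2 * P * t)) / 2 * Real.exp (q * N₀) *
        Real.exp (q * n))) ≤ Real.exp (-((P - q * a₁) * t)) :=
      Real.sqrt_le_iff.2 ⟨(Real.exp_pos _).le, hsmall⟩
    have e2 : (n : ℝ) ≤ Real.exp (a₁ * t) := by linarith [Real.add_one_le_exp (a₁ * t)]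
    have e3 := le_exp_div_mul ht₀ ht (show 0 ≤ 64 / C₃ by positivity)
    have e4 : 64 / C₃ * (Real.exp (a₁ * t) * Real.exp (-((P - q * a₁) * t))) ≤
        Real.exp (-(C₂ * t)) := by
      calc _ ≤ Real.exp (64 / C₃ / t₀ * t) *
            (Real.exp (a₁ * t) * Real.exp (-((P - q * a₁) * t))) := by gcongr
        _ = _ := by
            rw [← Real.exp_add, ← Real.exp_add, hP]
            ring_nf
    have e5 := le_exp_div_mul ht₀ ht (show 0 ≤ 4 * c / C₃ by positivity)
    have e6 : 4 * c / C₃ * (Real.exp t * Real.exp (-(l * n))) ≤ Real.exp (-(C₂ * t)) := by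
      calc _ ≤ Real.exp (4 * c / C₃ / t₀ * t) * (Real.exp t * Real.exp (-(l * n))) := by gcongr
        _ ≤ _ := by
            rw [← Real.exp_add, ← Real.exp_add]
            gcongr
            have h1 : l * (a * t) ≤ l * n := mul_le_mul_of_nonneg_left hn1 hl.le
            have h2 : l * a = 4 * c / C₃ / t₀ + 1 + C₂ + l * (N₀ / t₀) := by
              rw [ha]
              field_simp
            have h3 : 0 ≤ l * (N₀ / t₀) * t := by positivity
            rw [← mul_assoc, h2] at h1
            linarith
    have e7 : (n : ℝ) * Real.sqrt (2 * (Real.exp (-(2 * P * t)) / 2 * Real.exp (q * N₀) *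
        Real.exp (q * n))) ≤ Real.exp (a₁ * t) * Real.exp (-((P - q * a₁) * t)) :=
      mul_le_mul e2 e1 (Real.sqrt_nonneg _) (Real.exp_pos _).le
    rw [div_mul_eq_mul_div, div_le_iff₀ hC₃] at e4 e6
    have := mul_pos hC₃ (Real.exp_pos (-(C₂ * t)))
    linarith
  · have : Real.exp (-(q * (C₈ * t)) - 2 * P * t) ≤ 1 := by
      rw [← neg_add']
      exact hexp_le _ (by positivity)
    linarith
  · have e1 : Real.exp (-(l * ⌊C₈ * t⌋₊)) ≤ Real.exp (-(l * k)) := by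
      rw [hkR]
      gcongr
      have : (0 : ℝ) ≤ n + N₀ + m := by positivity
      linarith
    have e2 := Real.one_le_exp ht0.le
    have e3 := hexp_le (2 * P * t) (by positivity)
    have e4 : 1 ≤ K * Real.exp t := one_le_mul_of_one_le_of_one_le hK e2
    have e5 := mul_le_mul_of_nonneg_right e4 (Real.exp_pos (-(l * k))).le
    linarith

/-! ### Approximate invariance under twisted holonomies -/

section Holonomy

variable {φ r : OneSided A → ℝ} {b lam : ℝ}

/-- Since `σ^n` identifies the two points, `e^{ibr_n} g` is near the same value of `f` at both;
dividing by the phase at `x` leaves `e^{ibΔ^s}`. -/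
theorem stable_near {g : OneSided A → ℂ} {f : OneSided A → ℂ} {δ : ℝ} {n : ℕ}
    (hg : ∀ y, ‖Complex.exp (Complex.I * (b : ℂ) * ((birkhoffSum shift r n y : ℝ) : ℂ)) * g y -
      f (shift^[n] y)‖ ≤ δ) {x y : TwoSided A} (h : y ∈ stableSet n x) :
    ‖Complex.exp (Complex.I * (b : ℂ) * (deltaS r x y : ℂ)) * g (proj y) - g (proj x)‖ ≤
      2 * δ := by
  have e1 := hg (proj x)
  have e2 := hg (proj y)
  rw [shift_iterate_proj_eq h] at e2
  rw [deltaS_eq h, roofSum_eq, roofSum_eq]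
  have n1 := norm_exp_I_mul b (birkhoffSum shift r n (proj x))
  have hE : Complex.exp (Complex.I * (b : ℂ) * ((birkhoffSum shift r n (proj x) : ℝ) : ℂ)) *
      Complex.exp (Complex.I * (b : ℂ) *
        ((birkhoffSum shift r n (proj y) - birkhoffSum shift r n (proj x) : ℝ) : ℂ)) =
      Complex.exp (Complex.I * (b : ℂ) * ((birkhoffSum shift r n (proj y) : ℝ) : ℂ)) := by
    rw [← Complex.exp_add]
    push_cast
    ring_nf
  rw [← hE] at e2
  set E := Complex.exp (Complex.I * (b : ℂ) * ((birkhoffSum shift r n (proj x) : ℝ) : ℂ))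
  set F := Complex.exp (Complex.I * (b : ℂ) *
    ((birkhoffSum shift r n (proj y) - birkhoffSum shift r n (proj x) : ℝ) : ℂ))
  set w := f (shift^[n] (proj x))
  calc ‖F * g (proj y) - g (proj x)‖ = ‖E * (F * g (proj y) - g (proj x))‖ := by
        rw [norm_mul, n1, one_mul]
    _ = ‖(E * F * g (proj y) - w) - (E * g (proj x) - w)‖ := by congr 1; ring
    _ ≤ 2 * δ := (norm_sub_le _ _).trans (by linarith)

/-- Pulled back by `σ^{-k}`, the points are `λ^{k-n}`-close, so `h` barely distinguishes them.
Pushing forward recovers `g` up to the phases `e^{ibr_k}`, whose ratio is `e^{ibΔ^u}` up to a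
geometric tail. -/
theorem unstable_near (h₀ : 0 < lam) (h₁ : lam < 1) {Kr K : ℝ} (hKr₀ : 0 ≤ Kr) (hK₀ : 0 ≤ K)
    (hKr : ∀ x y, ‖r x - r y‖ ≤ Kr * symDist lam x y) {h g : OneSided A → ℂ}
    (hh : ∀ x, ‖h x‖ ≤ 1) (hK : ∀ x y, ‖h x - h y‖ ≤ K * symDist lam x y) {δ : ℝ} {n k : ℕ}
    (hg : ∀ y, ‖Complex.exp (Complex.I * (b : ℂ) * ((birkhoffSum shift r k y : ℝ) : ℂ)) * h y -
      g (shift^[k] y)‖ ≤ δ) {x y : TwoSided A} (hxy : y ∈ unstableSet n x) :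
    ‖Complex.exp (Complex.I * (b : ℂ) * (deltaU r x y : ℂ)) * g (proj y) - g (proj x)‖ ≤
      2 * δ + (K + |b| * Kr / (1 - lam)) * (lam ^ k / lam ^ n) := by
  set x' := proj (shiftBy (-(k : ℤ)) x) with hx'
  set y' := proj (shiftBy (-(k : ℤ)) y) with hy'
  have e1 := hg x'
  have e2 := hg y'
  rw [hx', shift_iterate_proj_shiftBy, ← hx'] at e1
  rw [hy', shift_iterate_proj_shiftBy, ← hy'] at e2
  have e3 := abs_deltaU_sub_le h₀ h₁ hKr₀ hKr hxy k
  rw [roofSum_eq, roofSum_eq, ← hx', ← hy'] at e3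
  have e4 : ‖h x' - h y'‖ ≤ K * (lam ^ k / lam ^ n) :=
    (hK x' y').trans (mul_le_mul_of_nonneg_left (symDist_proj_shiftBy_le h₀ h₁ hxy k) hK₀)
  set s := birkhoffSum shift r k x'
  set t := birkhoffSum shift r k y'
  have e5 := (norm_exp_I_mul_sub_le b (deltaU r x y + t) s).trans
    (mul_le_mul_of_nonneg_left
      ((congrArg abs (sub_sub_eq_add_sub (deltaU r x y) s t)).symm.le.trans e3) (abs_nonneg b))
  have hE : Complex.exp (Complex.I * (b : ℂ) * ((deltaU r x y + t : ℝ) : ℂ)) =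
      Complex.exp (Complex.I * (b : ℂ) * (deltaU r x y : ℂ)) *
        Complex.exp (Complex.I * (b : ℂ) * (t : ℂ)) := by
    rw [← Complex.exp_add]
    push_cast
    ring_nf
  rw [hE] at e5
  have n1 := norm_exp_I_mul b (deltaU r x y)
  have n2 := norm_exp_I_mul b t
  have n3 := norm_exp_I_mul b s
  set D := Complex.exp (Complex.I * (b : ℂ) * (deltaU r x y : ℂ))
  set T := Complex.exp (Complex.I * (b : ℂ) * (t : ℂ))
  set S := Complex.exp (Complex.I * (b : ℂ) * (s : ℂ))
  calc ‖D * g (proj y) - g (proj x)‖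
      = ‖-(D * (T * h y' - g (proj y))) + (D * T - S) * h y' + -(S * (h x' - h y')) +
          (S * h x' - g (proj x))‖ := by congr 1; ring
    _ ≤ ‖-(D * (T * h y' - g (proj y)))‖ + ‖(D * T - S) * h y'‖ + ‖-(S * (h x' - h y'))‖ +
          ‖S * h x' - g (proj x)‖ := norm_add₄_le
    _ ≤ δ + |b| * (Kr / lam ^ n * lam ^ k / (1 - lam)) * 1 + K * (lam ^ k / lam ^ n) + δ := by
        simp only [norm_neg, norm_mul, n1, n3, one_mul]
        exact add_le_add (add_le_add (add_le_add e2 (mul_le_mul e5 (hh y') (norm_nonneg _)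
          (by positivity))) e4) e1
    _ = _ := by ring

end Holonomy

/-! ### The Dolgopyat type estimate -/

/-- If `|𝓛_bⁿ h|` comes polynomially close to one at a point, then `𝓛_b` has an approximate
eigenfunction, which the Diophantine non-integrability property rules out. -/
theorem DiophantineNonintegrable.dolgopyatEstimate (hA : IsZeroOne A) (hA' : IsAperiodic A)
    {lam : ℝ} (h₀ : 0 < lam) (h₁ : lam < 1) {r φ : OneSided A → ℝ} (hr : IsLip lam r)
    (hφ : IsLip lam φ) (hφ₁ : IsNormalized φ) {w₀ : TwoSided A} {C₂ C₃ C₄ : ℝ} {N₀ : ℕ}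
    (hC₂ : 0 < C₂) (hC₃ : 0 < C₃) (hC₄ : 1 < C₄)
    (hD : DiophantineNonintegrable r C₂ C₃ C₄ w₀ N₀) : DolgopyatEstimate lam φ r C₄ := by
  obtain ⟨m, -, hm⟩ := hA'
  obtain ⟨Kφ, hKφ₀, hKφ⟩ := hφ.exists_pos h₀
  obtain ⟨Kr, hKr₀, hKr⟩ := hr.exists_pos h₀
  have : Nonempty (OneSided A) := ⟨proj w₀⟩
  have hl₁ : 0 < 1 - lam := sub_pos.2 h₁
  obtain ⟨q, hq₀, hq⟩ : ∃ q : ℝ, 0 ≤ q ∧ ∀ x, -q ≤ φ x := by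
    refine ⟨|φ (proj w₀)| + Kφ, by positivity, fun x => ?_⟩
    have e1 := (hKφ x (proj w₀)).trans
      (mul_le_mul_of_nonneg_left (symDist_le_one h₀ h₁ _ _) hKφ₀.le)
    rw [Real.norm_eq_abs, abs_le] at e1
    linarith [e1.1, neg_abs_le (φ (proj w₀))]
  set C := 2 * (N * (Kφ + Kr) + 2) / (1 - lam) with hCdef
  have hC : 2 * (N * (Kφ + Kr) + 2) = C * (1 - lam) := by
    rw [hCdef]
    field_simp
  have hC1 : 1 ≤ C := by
    rw [hCdef, le_div_iff₀ hl₁]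
    have : 0 ≤ N * (Kφ + Kr) := by positivity
    linarith
  have hC0 : 0 < C := by linarith
  -- The Lipschitz and tail errors of `unstable_near`, with `|b| λ^n` factored out and multiplied by
  -- the 4 of `norm_exp_displacement_sub_one_le`.
  set c := 4 * ((C + Kr / (1 - lam)) / lam ^ N₀) with hc
  have hlog : 0 < -Real.log lam := neg_pos.2 (Real.log_neg h₀ h₁)
  have hlampow : ∀ j : ℕ, Real.exp (-(-Real.log lam * j)) = lam ^ j := fun j => by
    rw [neg_mul, neg_neg, mul_comm, Real.exp_nat_mul, Real.exp_log h₀]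
  obtain ⟨C₈, C₉, hC₈, hC₉, hpar⟩ := exists_exponents (Real.log_pos hC₄) hlog hq₀ hC₂ hC₃ hC1
    (show 0 ≤ c by positivity) m N₀
  refine ⟨C₈, C₉, C, hC₈, hC₉, hC0, fun b hb h hh => ?_⟩
  have hb1 : 1 < |b| := hC₄.trans_le hb
  have hb0 : 0 < |b| := by linarith
  have hCb : 0 < C * |b| := by positivity
  have hrpow : ∀ s : ℝ, |b| ^ (-s) = Real.exp (-(s * Real.log |b|)) := fun s => by
    rw [Real.rpow_def_of_pos hb0]
    ring_nf
  obtain ⟨k, n, η, hN₀n, hsum, hη, hη₀, hhalf, herr, hε, hlamn⟩ := hpar (Real.log |b|)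
    (Real.log_le_log (by linarith) hb)
  simp only [hlampow, Real.exp_log hb0, ← hrpow] at hη herr hε hlamn
  set ε := |b| ^ (-C₉) with hεdef
  set n' := ⌊C₈ * Real.log |b|⌋₊ with hn'
  have hmain : ∀ h : OneSided A → ℂ, BoundedLip lam 1 (C * |b|) h → ∀ x,
      ‖(twisted φ r b)^[n'] h x‖ ≤ 1 - ε := by
    intro h hh x
    by_contra! hx
    have hL : ∀ j, BoundedLip lam 1 (C * |b|) ((twisted φ r b)^[j] h) := fun j => by
      refine ((mul_one (C * |b|)).symm ▸ hh).twisted_iterate h₀ h₁ hφ₁ hKφ₀.le hKr₀.le hKφ hKr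
        hb1.le zero_le_one hC hC0.le j |>.mono h₀ ?_
      have := pow_le_one₀ (n := j) h₀.le h₁.le
      nlinarith
    -- The iterate is split into three blocks: `n` steps for unstable holonomy, `N₀` for stable
    -- holonomy, and `m + k` to spread the near-maximal modulus from `x` to the whole space.
    set g := (twisted φ r b)^[n] h with hg
    set g' := (twisted φ r b)^[N₀] g with hg'
    have hgj : g' = (twisted φ r b)^[n + N₀] h := by
      rw [hg', hg, ← Function.iterate_add_apply, add_comm]
    have hg'B : BoundedLip lam 1 (C * |b|) g' := hgj ▸ hL _
    have hx' : 1 - ε ≤ ‖(twisted φ r b)^[m + k] g' x‖ := by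
      rw [hgj, ← Function.iterate_add_apply, add_comm (m + k), hsum]
      exact hx.le
    have hg'1 : ∀ z, 1 - η ≤ ‖g' z‖ := by
      intro z
      obtain ⟨y, hy, hyz⟩ := exists_preimage_agree hA hm k x z
      rw [← hy] at hx'
      have e1 := norm_ge_of_iterate hφ₁ hq hg'B.1 (m + k) y hx'
      have e2 := (hg'B.2 y z).trans (mul_le_mul_of_nonneg_left
        (symDist_le_pow h₀ h₁ fun i hi => hyz i (le_of_lt hi)) hCb.le)
      have e3 := norm_le_norm_sub_add (g' y) (g' z)
      linarith
    have hs := iterate_near (r := r) (b := b) hφ₁ hq₀ hq (hL n).1 hη₀ N₀ hg'1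
    have hg1 : ∀ y, 1 - η * Real.exp (q * N₀) ≤ ‖g y‖ := fun y =>
      norm_ge_of_iterate hφ₁ hq (hL n).1 N₀ y (hg'1 _)
    have hu := iterate_near (r := r) (b := b) hφ₁ hq₀ hq hh.1 (by positivity) n hg1
    obtain ⟨w₁, w₂, w₃, hw, hlow⟩ := hD b hb
    have hup := norm_exp_displacement_sub_one_le (g := g) (b := b)
      (fun x y hxy => unstable_near h₀ h₁ hKr₀.le hCb.le hKr hh.1 hh.2 hu hxy)
      (fun x y hxy => stable_near hs hxy) (by linarith [hg1 (proj w₀)]) hw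
    -- As `N₀ ≤ n`, the stable error is dominated by the unstable one, so four copies of it times 4
    -- give the 16 in `herr`.
    have hcmp : (N₀ : ℝ) * Real.sqrt (2 * (η * Real.exp (q * N₀))) ≤
        n * Real.sqrt (2 * (η * Real.exp (q * N₀) * Real.exp (q * n))) := by
      have hle : η * Real.exp (q * N₀) ≤ η * Real.exp (q * N₀) * Real.exp (q * n) :=
        le_mul_of_one_le_right (by positivity) (Real.one_le_exp (by positivity))
      gcongr
    have hlast : 4 * ((C * |b| + |b| * Kr / (1 - lam)) * (lam ^ n / lam ^ N₀)) =
        c * |b| * lam ^ n := by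
      rw [hc]
      ring
    linarith
  have hB := hh.boundedLip h₀ h₁ hCb
  set M := bNorm lam C b h with hM
  have hM0 : 0 ≤ M := (norm_nonneg _).trans (hB.1 (proj w₀))
  have hBn := hB.twisted_iterate h₀ h₁ hφ₁ hKφ₀.le hKr₀.le hKφ hKr hb1.le hM0 hC hC0.le n'
  refine ⟨hBn.isLip, ?_⟩
  have hsup : ∀ x, ‖(twisted φ r b)^[n'] h x‖ ≤ (1 - ε) * M := by
    -- The scaling by `M⁻¹` needs `M > 0`; when `M = 0` the contraction of the supremum norm
    -- suffices.
    rcases hM0.eq_or_lt with hM00 | hMpos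
    · intro x
      rw [← hM00, mul_zero]
      exact norm_twisted_iterate_le hφ₁ (fun x => (hB.1 x).trans hM00.ge) n' x
    · intro x
      have hMC : ‖((M⁻¹ : ℝ) : ℂ)‖ = M⁻¹ := by
        rw [Complex.norm_real, Real.norm_of_nonneg (inv_nonneg.2 hM0)]
      have e := hmain (fun x => ((M⁻¹ : ℝ) : ℂ) * h x) ⟨fun x => by
        rw [norm_mul, hMC, inv_mul_le_iff₀ hMpos, mul_one]
        exact hB.1 x, fun x y => by
        rw [← mul_sub, norm_mul, hMC, inv_mul_le_iff₀ hMpos]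
        exact (hB.2 x y).trans (le_of_eq (by ring))⟩ x
      rw [twisted_iterate_smul, norm_mul, hMC, inv_mul_le_iff₀ hMpos] at e
      linarith
  refine BoundedLip.bNorm_le h₀ hCb (by positivity) ⟨hsup, hBn.2⟩ le_rfl ?_
  -- With `λ^{n'} ≤ 1/4` and `ε ≤ 1/4`, the Lipschitz factor `(1 + λ^{n'})/2 ≤ 5/8` lies below `1 -
  -- ε`.
  rw [mul_assoc (C * |b|)]
  refine mul_le_mul_of_nonneg_left ?_ hCb.le
  nlinarith

/-! ### Non-integrability from a Diophantine ratio -/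

/-- Lets two quadrilaterals of different sizes be used at one common `N₀`. -/
theorem IsQuadrilateral.mono {n n' : ℕ} (hn : n ≤ n') {w₀ w₁ w₂ w₃ : TwoSided A}
    (h : IsQuadrilateral n w₀ w₁ w₂ w₃) : IsQuadrilateral n' w₀ w₁ w₂ w₃ := by
  have hn' : (n : ℤ) ≤ n' := by exact_mod_cast hn
  exact ⟨fun i hi => h.1 i (by omega), fun i hi => h.2.1 i (by omega),
    fun i hi => h.2.2.1 i (by omega), fun i hi => h.2.2.2 i (by omega)⟩

/-- The distance from `t` to `2 π ℤ` is at most `π / 2 · |e^{it} - 1|`. -/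
theorem exists_int_abs_sub_le (t : ℝ) :
    ∃ p : ℤ, |t - 2 * Real.pi * p| ≤ Real.pi / 2 * ‖Complex.exp (Complex.I * (t : ℂ)) - 1‖ := by
  refine ⟨round (t / (2 * Real.pi)), ?_⟩
  set p := round (t / (2 * Real.pi)) with hp
  have hpi := Real.pi_pos
  set s := t - 2 * Real.pi * p with hs
  have hsle : |s| ≤ Real.pi := by
    have h1 := abs_sub_round (t / (2 * Real.pi))
    rw [← hp] at h1
    have h2 : s = 2 * Real.pi * (t / (2 * Real.pi) - p) := by
      rw [hs]
      field_simp
    rw [h2, abs_mul, abs_of_pos (by positivity)]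
    nlinarith
  have hexp : Complex.exp (Complex.I * (t : ℂ)) = Complex.exp (Complex.I * (s : ℂ)) := by
    rw [Complex.exp_eq_exp_iff_exists_int]
    refine ⟨p, ?_⟩
    rw [hs]
    push_cast
    ring
  rw [hexp, Complex.norm_exp_I_mul_ofReal_sub_one, norm_mul, Real.norm_eq_abs, Real.norm_eq_abs,
    abs_two]
  have hsin : 2 / Real.pi * |s / 2| ≤ |Real.sin (s / 2)| := by
    refine Real.mul_abs_le_abs_sin ?_
    rw [abs_div, abs_two]
    linarith
  rw [abs_div, abs_two] at hsin
  have h3 : Real.pi * (2 / Real.pi * (|s| / 2)) = |s| := by field_simp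
  nlinarith

/-- Two displacements with Diophantine ratio give Diophantine non-integrability. -/
theorem exists_diophantineNonintegrable {r : OneSided A → ℝ} {w₀ : TwoSided A} {α β : ℝ}
    (hα : α ∈ temporalRange r w₀) (hβ : β ∈ temporalRange r w₀) (h : IsDiophantine (α / β)) :
    ∃ (C₂ C₃ C₄ : ℝ) (N₀ : ℕ), 0 < C₂ ∧ 0 < C₃ ∧ 1 < C₄ ∧ 1 ≤ N₀ ∧
      DiophantineNonintegrable r C₂ C₃ C₄ w₀ N₀ := by
  obtain ⟨C, γ, hC, hγ, hdio⟩ := h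
  obtain ⟨n, u₁, u₂, u₃, hu, rfl⟩ := hα
  obtain ⟨n', v₁, v₂, v₃, hv, rfl⟩ := hβ
  set α := displacement r w₀ u₁ u₂ u₃
  set β := displacement r w₀ v₁ v₂ v₃
  have hpi := Real.pi_pos
  have hpi3 := Real.pi_gt_three
  have hβ0 : β ≠ 0 := by
    intro h0
    have h1 := hdio 0 1 one_ne_zero
    simp [h0] at h1
    linarith
  set a := α / β with ha
  have hab : α = a * β := by
    rw [ha]
    field_simp
  have hβ' : 0 < |β| := abs_pos.2 hβ0
  set Q := |β| + 1 with hQ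
  -- The first entry of the minimum keeps `δ < 1`, which excludes `k = 0`; the second, with `|k| ≤
  -- Q|b|`, contradicts the Diophantine bound.
  set C₃ := min 1 (C * Q ^ (-γ) / (1 + |a|)) / 2 with hC₃
  have hC₃0 : 0 < C₃ := by positivity
  have hC₃1 : C₃ < 1 := by
    have := min_le_left 1 (C * Q ^ (-γ) / (1 + |a|))
    linarith
  have hC₃2 : C₃ * (1 + |a|) < C * Q ^ (-γ) := by
    have e1 := min_le_right 1 (C * Q ^ (-γ) / (1 + |a|))
    have e2 : 0 < C * Q ^ (-γ) / (1 + |a|) := by positivity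
    rw [← lt_div_iff₀ (by positivity)]
    linarith
  refine ⟨γ, C₃, 2 + 2 * Real.pi / |β|, max 1 (max n n'), hγ, hC₃0, ?_, le_max_left _ _, ?_⟩
  · have : 0 < 2 * Real.pi / |β| := by positivity
    linarith
  intro b hb
  have hb2 : 2 * Real.pi ≤ |b| * |β| := by
    rw [← div_le_iff₀ hβ']
    linarith
  have hb1 : 1 < |b| := by
    have : 0 < 2 * Real.pi / |β| := by positivity
    linarith
  by_contra! hcon
  have hα' := hcon u₁ u₂ u₃ (hu.mono (by omega))
  have hβ'' := hcon v₁ v₂ v₃ (hv.mono (by omega))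
  set δ := C₃ * |b| ^ (-γ) with hδ
  have hδ1 : δ < 1 := by
    have : |b| ^ (-γ) ≤ 1 := Real.rpow_le_one_of_one_le_of_nonpos hb1.le (by linarith)
    have h0 : 0 ≤ |b| ^ (-γ) := by positivity
    nlinarith
  obtain ⟨p, hp⟩ := exists_int_abs_sub_le (b * α)
  obtain ⟨k, hk⟩ := exists_int_abs_sub_le (b * β)
  push_cast at hp hk
  rw [← mul_assoc] at hp hk
  have hp' : |b * α - 2 * Real.pi * p| ≤ Real.pi / 2 * δ := hp.trans (by gcongr)
  have hk' : |b * β - 2 * Real.pi * k| ≤ Real.pi / 2 * δ := hk.trans (by gcongr)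
  have hbβ : |b * β| = |b| * |β| := abs_mul _ _
  -- If `k = 0`, then `|bβ| < π/2`, whereas the choice of `C₄` gives `|bβ| ≥ 2π`.
  have hk0 : k ≠ 0 := by
    rintro rfl
    simp only [Int.cast_zero, mul_zero, sub_zero] at hk'
    nlinarith
  have hkle : |(k : ℝ)| ≤ Q * |b| := by
    have e1 := abs_sub_abs_le_abs_sub (2 * Real.pi * (k : ℝ)) (b * β)
    rw [abs_sub_comm (2 * Real.pi * (k : ℝ)), abs_mul, abs_of_pos (by positivity : 0 < 2 * Real.pi)]
      at e1
    have e2 : 0 ≤ |b| * |β| := by positivity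
    have e3 : 2 * Real.pi * |(k : ℝ)| ≤ |b| * |β| + Real.pi / 2 := by nlinarith
    nlinarith [abs_nonneg (k : ℝ)]
  have hkpos : 0 < |(k : ℝ)| := abs_pos.2 (by exact_mod_cast hk0)
  have hlow : C * (Q ^ (-γ) * |b| ^ (-γ)) ≤ |(k : ℝ) * a - p| := by
    refine le_trans ?_ (hdio p k hk0)
    rw [← Real.mul_rpow (by positivity) (abs_nonneg b)]
    exact mul_le_mul_of_nonneg_left
      (Real.rpow_le_rpow_of_nonpos hkpos hkle (by linarith)) hC.le
  -- Since `α = aβ`, subtracting `a` times the approximation of `bβ` from that of `bα` eliminates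
  -- `b`.
  have hup : 2 * Real.pi * |(k : ℝ) * a - p| ≤ Real.pi / 2 * δ * (1 + |a|) := by
    rw [← abs_of_pos (by positivity : 0 < 2 * Real.pi), ← abs_mul]
    calc _ = |(b * α - 2 * Real.pi * p) - a * (b * β - 2 * Real.pi * k)| := by
          rw [hab]
          congr 1
          ring
      _ ≤ |b * α - 2 * Real.pi * p| + |a| * |b * β - 2 * Real.pi * k| := by
          rw [← abs_mul]
          exact abs_sub _ _
      _ ≤ Real.pi / 2 * δ + |a| * (Real.pi / 2 * δ) := by gcongr
      _ = _ := by ring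
  have hbγ : 0 < |b| ^ (-γ) := by positivity
  have hfin : δ * (1 + |a|) < |(k : ℝ) * a - p| := by
    rw [hδ]
    have := mul_lt_mul_of_pos_right hC₃2 hbγ
    linarith
  have : 0 < δ * (1 + |a|) := by positivity
  nlinarith

end Subshift

theorem mainTheorem3 {N : ℕ} (A : Matrix (Fin N) (Fin N) ℕ)
    (hA : Subshift.IsZeroOne A) (hA' : Subshift.IsAperiodic A)
    (lam : ℝ) (hlam₀ : 0 < lam) (hlam₁ : lam < 1)
    (r φ : Subshift.OneSided A → ℝ)
    (hr : Subshift.IsLip lam r) (hr₀ : ∀ x, 0 < r x)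
    (hφ : Subshift.IsLip lam φ) (hφ₁ : Subshift.IsNormalized φ)
    (w₀ : Subshift.TwoSided A) :
    (∀ (C₂ C₃ C₄ : ℝ) (N₀ : ℕ), 0 < C₂ → 0 < C₃ → 1 < C₄ → 1 ≤ N₀ →
      Subshift.DiophantineNonintegrable r C₂ C₃ C₄ w₀ N₀ →
        Subshift.DolgopyatEstimate lam φ r C₄) ∧
    (∀ α ∈ Subshift.temporalRange r w₀, ∀ β ∈ Subshift.temporalRange r w₀,
      Subshift.IsDiophantine (α / β) →
        ∃ (C₂ C₃ C₄ : ℝ) (N₀ : ℕ), 0 < C₂ ∧ 0 < C₃ ∧ 1 < C₄ ∧ 1 ≤ N₀ ∧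
          Subshift.DiophantineNonintegrable r C₂ C₃ C₄ w₀ N₀ ∧
          Subshift.DolgopyatEstimate lam φ r C₄) := by
  refine ⟨fun C₂ C₃ C₄ N₀ hC₂ hC₃ hC₄ _ hD =>
    hD.dolgopyatEstimate hA hA' hlam₀ hlam₁ hr hφ hφ₁ hC₂ hC₃ hC₄, fun α hα β hβ h => ?_⟩
  obtain ⟨C₂, C₃, C₄, N₀, hC₂, hC₃, hC₄, hN₀, hD⟩ :=
    Subshift.exists_diophantineNonintegrable hα hβ h
  exact ⟨C₂, C₃, C₄, N₀, hC₂, hC₃, hC₄, hN₀, hD,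
    hD.dolgopyatEstimate hA hA' hlam₀ hlam₁ hr hφ hφ₁ hC₂ hC₃ hC₄⟩
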